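/- Theorem 1.3. Let $p$ be a prime and let $c,d$ be odd positive integers such that $p\nmid cd$, $c$ is cube-free, $d$ is square-free and $\gcd(c,d)=1$. Put $l=\gcd(cd,p-1)$, $m=\gcd(d,p-1)$, $s=\gcd(cd,p+1)$ and $Q=\mathbb Z_{cd}\times\mathbb Z_d$, and let $\tau(n)$ denote the number of positive divisors of $n$. Split extensions are counted up to isomorphism of groups. A subgroup of $\mathrm{GL}(2,p)$ is called reducible if it leaves invariant a one-dimensional subspace of $\mathbb F_p^2$. (i) For every $t\mid lm$ the group $Q$ has a subgroup $H(t)$ of order $t$, and any two subgroups of $Q$ of the same order are isomorphic. Let $N_{red}(H(t))$ denote the number of conjugacy classes in $\mathrm{GL}(2,p)$ of reducible subgroups of $\mathrm{GL}(2,p)$ isomorphic to $H(t)$. Then the number of isomorphism classes of split extensions of $\mathbb Z_p\times\mathbb Z_p$ by $Q$ (groups of the form $(\mathbb Z_p\times\mathbb Z_p)\rtimes Q$) is $$\sum_{t\mid lm} N_{red}(H(t))+\Omega(s,l),\qquad \Omega(s,l)=\begin{cases}0 & \text{if } s=1,\\ \tau(l)(\tau(s)-1) & \text{otherwise.}\end{cases}$$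 (ii) For every positive integer $\alpha$, the number of isomorphism classes of split extensions of $\mathbb Z_{p^\alpha}$ by $Q$ is $\tau(l)$. -/

import Mathlib

/-- `G` is a split extension of `N` by `Q`: there is a short exact sequence
`1 → N → G → Q → 1` with a section `Q → G` that is a group homomorphism. -/
def IsSplitExtension (N Q G : Type) [Group N] [Group Q] [Group G] : Prop :=
  ∃ S : GroupExtension N G Q, Nonempty S.Splitting

/-- Isomorphism of groups, as an equivalence relation on the split extensions of `N` by `Q`. -/
def splitExtensionSetoid (N Q : Type) [Group N] [Group Q] :
    Setoid {G : GrpCat.{0} // IsSplitExtension N Q G} where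
  r G₁ G₂ := Nonempty ((G₁ : GrpCat.{0}) ≃* (G₂ : GrpCat.{0}))
  iseqv :=
    { refl := fun _ => ⟨MulEquiv.refl _⟩
      symm := fun ⟨e⟩ => ⟨e.symm⟩
      trans := fun ⟨e⟩ ⟨f⟩ => ⟨e.trans f⟩ }

/-- The number of isomorphism classes of split extensions of `N` by `Q`. -/
noncomputable def numSplitExtensions (N Q : Type) [Group N] [Group Q] : ℕ :=
  Nat.card (Quotient (splitExtensionSetoid N Q))

/-- A subgroup `K` of `GL(2, p)` is reducible if it leaves invariant a nonzero proper subspace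
of the natural module. -/
def IsReducibleSubgroup {p : ℕ} (K : Subgroup (GL (Fin 2) (ZMod p))) : Prop :=
  ∃ W : Submodule (ZMod p) (Fin 2 → ZMod p), W ≠ ⊥ ∧ W ≠ ⊤ ∧
    ∀ g ∈ K, ∀ v ∈ W, (g : Matrix (Fin 2) (Fin 2) (ZMod p)).mulVec v ∈ W

/-- The reducible subgroups of `GL(2, p)` that are isomorphic to `H`. -/
def ReducibleCopies (p : ℕ) (H : Type) [Group H] : Type :=
  {K : Subgroup (GL (Fin 2) (ZMod p)) // IsReducibleSubgroup K ∧ Nonempty (K ≃* H)}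

/-- Two reducible copies of `H` are equivalent when they are conjugate in `GL(2, p)`. -/
def reducibleCopiesSetoid (p : ℕ) (H : Type) [Group H] : Setoid (ReducibleCopies p H) where
  r K₁ K₂ := ∃ g : GL (Fin 2) (ZMod p), K₂.1 = K₁.1.map (MulAut.conj g).toMonoidHom
  iseqv :=
    { refl := fun K => ⟨1, by ext x; simp⟩
      symm := by
        rintro K₁ K₂ ⟨g, hg⟩
        refine ⟨g⁻¹, ?_⟩
        rw [hg, Subgroup.map_map]
        ext x
        simp [mul_assoc]
      trans := by
        rintro K₁ K₂ K₃ ⟨g, hg⟩ ⟨h, hh⟩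
        refine ⟨h * g, ?_⟩
        rw [hh, hg, Subgroup.map_map]
        ext x
        simp [mul_assoc] }

/-- `N_red(H)`: the number of conjugacy classes of reducible subgroups of `GL(2, p)` that are
isomorphic to `H`. -/
noncomputable def Nred (p : ℕ) (H : Type) [Group H] : ℕ :=
  Nat.card (Quotient (reducibleCopiesSetoid p H))

/-- `τ(n)`, the number of divisors of `n`. -/
def tau (n : ℕ) : ℕ := n.divisors.card

/-- `Ω(s, l)`. -/
def Omega (s l : ℕ) : ℕ := if s = 1 then 0 else tau l * (tau s - 1)

/-- The cyclic group of order `n`, written multiplicatively. -/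
abbrev Cyc (n : ℕ) : Type := Multiplicative (ZMod n)

/-! Write `N` for the normal factor and `Q` for the quotient. Since `N` is commutative of order
prime to `|Q|`, it is characteristic in every semidirect product, so `N ⋊[φ] Q` and `N ⋊[ψ] Q` are
isomorphic exactly when `φ` and `ψ` differ by automorphisms of `N` and of `Q`
(`SemidirectProduct.nonempty_mulEquiv_iff`). Two homomorphisms out of this particular `Q` with the
same image differ by an automorphism of `Q` (`exists_mulAut_of_range_eq`). Hence the count is the
number of conjugacy classes of subgroups of `Aut N` that are images of `Q`.

For `Aut N = GL(2, p)`, a reducible image has exponent dividing `p - 1`, so its order `t` divides `l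
* m`; the order fixes its isomorphism type, and these classes contribute the sum of the `Nred`. An
irreducible image is commutative, hence cyclic, and is determined up to conjugacy by its order `n`.
The orders that occur are those with `n ∣ c * d`, `n ∣ p ^ 2 - 1` and `¬ n ∣ p - 1`, that is, the
divisors of `l * s` that do not divide `l`. As `l` and `s` are coprime, there are `Omega s l` of
them.

For `Aut N = (ZMod (p ^ α))ˣ` conjugacy is equality, and the images of `Q` are the subgroups of
order dividing `l`, one for each divisor. -/

open SemidirectProduct

/-! ### Split extensions and conjugacy classes of images -/

/-- Conjugacy, on the subgroups of `A` that are homomorphic images of `Q`. -/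
def imageConjSetoid (Q A : Type*) [Group Q] [Group A] :
    Setoid {K : Subgroup A // ∃ φ : Q →* A, φ.range = K} where
  r K₁ K₂ := ∃ g : A, K₂.1 = K₁.1.map (MulAut.conj g).toMonoidHom
  iseqv :=
    { refl := fun K => ⟨1, by ext x; simp⟩
      symm := by
        rintro K₁ K₂ ⟨g, hg⟩
        refine ⟨g⁻¹, ?_⟩
        rw [hg, Subgroup.map_map]
        ext x
        simp [mul_assoc]
      trans := by
        rintro K₁ K₂ K₃ ⟨g, hg⟩ ⟨h, hh⟩
        refine ⟨h * g, ?_⟩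
        rw [hh, hg, Subgroup.map_map]
        ext x
        simp [mul_assoc] }

theorem isSplitExtension_iff {N Q G : Type} [Group N] [Group Q] [Group G] :
    IsSplitExtension N Q G ↔ ∃ φ : Q →* MulAut N, Nonempty (N ⋊[φ] Q ≃* G) := by
  constructor
  · rintro ⟨S, ⟨s⟩⟩
    exact ⟨s.conjAct, ⟨s.semidirectProductMulEquiv⟩⟩
  · rintro ⟨φ, ⟨e⟩⟩
    refine ⟨⟨e.toMonoidHom.comp inl, rightHom.comp e.symm.toMonoidHom, ?_, ?_, ?_⟩,
      ⟨⟨e.toMonoidHom.comp inr, ?_⟩⟩⟩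
    · exact e.injective.comp inl_injective
    · ext g
      obtain ⟨x, rfl⟩ := e.surjective g
      simp only [MonoidHom.mem_range, MonoidHom.mem_ker, MonoidHom.coe_comp, Function.comp_apply,
        MulEquiv.coe_toMonoidHom, MulEquiv.symm_apply_apply, EmbeddingLike.apply_eq_iff_eq]
      rw [← MonoidHom.mem_range, range_inl_eq_ker_rightHom, MonoidHom.mem_ker]
    · exact rightHom_surjective.comp e.symm.surjective
    · intro q
      simp

/-- In a semidirect product of groups of coprime order, the normal factor consists of the elements
of order dividing the order of that factor. -/
theorem SemidirectProduct.pow_card_eq_one_iff {N Q : Type*} [Group N] [Group Q]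
    (hcop : (Nat.card N).Coprime (Nat.card Q)) {φ : Q →* MulAut N} (x : N ⋊[φ] Q) :
    x ^ Nat.card N = 1 ↔ ∃ n, inl n = x := by
  constructor
  · intro hx
    have h1 : (rightHom x : Q) ^ Nat.card N = 1 := by rw [← map_pow, hx, map_one]
    have h2 : (rightHom x : Q) = 1 := by
      rw [← orderOf_eq_one_iff]
      exact Nat.eq_one_of_dvd_coprimes hcop (orderOf_dvd_of_pow_eq_one h1) (orderOf_dvd_natCard _)
    rw [← MonoidHom.mem_ker, ← range_inl_eq_ker_rightHom] at h2
    exact h2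
  · rintro ⟨n, rfl⟩
    rw [← map_pow, pow_card_eq_one', map_one]

/-- By coprimality an isomorphism carries `N` onto `N`, so it induces `a` on `N` and `b` on the
quotient `Q`. It need not carry the complement `Q` to the complement `Q`, but the discrepancy lies
in `N`, which acts trivially on itself because `N` is commutative. -/
theorem SemidirectProduct.nonempty_mulEquiv_iff {N Q : Type*} [CommGroup N] [Group Q]
    (hcop : (Nat.card N).Coprime (Nat.card Q)) {φ ψ : Q →* MulAut N} :
    Nonempty (N ⋊[φ] Q ≃* N ⋊[ψ] Q) ↔
      ∃ (a : MulAut N) (b : MulAut Q), ∀ q, ψ (b q) = a * φ q * a⁻¹ := by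
  constructor
  · rintro ⟨e⟩
    have hl (φ ψ : Q →* MulAut N) (e : N ⋊[φ] Q ≃* N ⋊[ψ] Q) (n : N) :
        inl (e (inl n)).left = e (inl n) := by
      have h : e (inl n) ^ Nat.card N = 1 := by
        rw [← map_pow, (pow_card_eq_one_iff hcop (inl n)).2 ⟨n, rfl⟩, map_one]
      obtain ⟨n', hn'⟩ := (pow_card_eq_one_iff hcop _).1 h
      rw [← hn', left_inl]
    have hr (φ ψ : Q →* MulAut N) (e : N ⋊[φ] Q ≃* N ⋊[ψ] Q) (x : N ⋊[φ] Q) :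
        (e x).right = (e (inr x.right)).right := by
      conv_lhs => rw [← inl_left_mul_inr_right x, map_mul, mul_right, ← hl, right_inl, one_mul]
    let a : MulAut N :=
      { toFun := fun n => (e (inl n)).left
        invFun := fun n => (e.symm (inl n)).left
        left_inv := fun n => by dsimp only; rw [hl, e.symm_apply_apply, left_inl]
        right_inv := fun n => by dsimp only; rw [hl, e.apply_symm_apply, left_inl]
        map_mul' := fun x y => by
          rw [map_mul, map_mul, ← hl _ _ e x, ← hl _ _ e y, ← map_mul]; simp }
    let b : MulAut Q :=
      { toFun := fun q => (e (inr q)).right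
        invFun := fun q => (e.symm (inr q)).right
        left_inv := fun q => by dsimp only; rw [← hr, e.symm_apply_apply, right_inr]
        right_inv := fun q => by dsimp only; rw [← hr, e.apply_symm_apply, right_inr]
        map_mul' := fun x y => by rw [map_mul, map_mul, mul_right] }
    refine ⟨a, b, fun q => ?_⟩
    rw [eq_mul_inv_iff_mul_eq]
    ext n
    have h : e (inr q) * e (inl n) = e (inl (φ q n)) * e (inr q) := by
      rw [← map_mul, ← map_mul, inl_aut]
      simp
    rw [← hl, ← hl _ _ e (φ q n)] at h
    -- Both sides contain the left component of `e (inr q)`; commutativity of `N` lets it cancel.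
    have h' := congrArg SemidirectProduct.left h
    simp only [mul_left, left_inl, right_inl, map_one, MulAut.one_apply] at h'
    rw [mul_comm] at h'
    exact mul_right_cancel h'
  · rintro ⟨a, b, h⟩
    refine ⟨SemidirectProduct.congr a b fun q => ?_⟩
    ext n
    have := congrArg (fun f => f (a n)) (h q)
    simpa using this.symm

/-- The hypothesis `hom` absorbs the automorphisms of `Q`: an action is then determined, up to
precomposition, by its image, and automorphisms of `N` act on images by conjugation. -/
theorem numSplitExtensions_eq_card_imageConj {N Q A : Type} [CommGroup N] [Group Q] [Group A]
    (hcop : (Nat.card N).Coprime (Nat.card Q)) (e : A ≃* MulAut N)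
    (hom : ∀ φ ψ : Q →* A, φ.range = ψ.range → ∃ b : MulAut Q, ∀ q, ψ (b q) = φ q) :
    numSplitExtensions N Q = Nat.card (Quotient (imageConjSetoid Q A)) := by
  have key (φ ψ : Q →* A) : Nonempty (N ⋊[e.toMonoidHom.comp φ] Q ≃* N ⋊[e.toMonoidHom.comp ψ] Q) ↔
      ∃ g : A, ψ.range = φ.range.map (MulAut.conj g).toMonoidHom := by
    rw [SemidirectProduct.nonempty_mulEquiv_iff hcop]
    constructor
    · rintro ⟨a, b, h⟩
      refine ⟨e.symm a, ?_⟩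
      have h' (q : Q) : ψ (b q) = e.symm a * φ q * (e.symm a)⁻¹ := by
        apply e.injective
        simpa using h q
      ext x
      simp only [MonoidHom.mem_range, Subgroup.mem_map, MulEquiv.coe_toMonoidHom,
        exists_exists_eq_and, MulAut.conj_apply, ← h']
      exact ⟨fun ⟨q, hq⟩ => ⟨b.symm q, by simpa using hq⟩, fun ⟨q, hq⟩ => ⟨b q, hq⟩⟩
    · rintro ⟨g, hg⟩
      rw [← MonoidHom.range_comp] at hg
      obtain ⟨b, hb⟩ := hom _ _ hg.symm
      exact ⟨e g, b, fun q => by simp [hb]⟩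
  symm
  let G (φ : Q →* A) : {G : GrpCat.{0} // IsSplitExtension N Q G} :=
    ⟨GrpCat.of (N ⋊[e.toMonoidHom.comp φ] Q), isSplitExtension_iff.2 ⟨_, ⟨MulEquiv.refl _⟩⟩⟩
  refine Nat.card_eq_of_bijective (Quotient.lift (fun K => Quotient.mk _ (G K.2.choose)) ?_) ⟨?_, ?_⟩
  · intro K₁ K₂ h
    apply Quotient.sound
    apply (key _ _).2
    rw [K₁.2.choose_spec, K₂.2.choose_spec]
    exact h
  · rintro ⟨K₁⟩ ⟨K₂⟩ h
    have := (key _ _).1 (Quotient.exact h)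
    rw [K₁.2.choose_spec, K₂.2.choose_spec] at this
    exact Quotient.sound this
  · rintro ⟨⟨E, hE⟩⟩
    obtain ⟨φ, ⟨f⟩⟩ := isSplitExtension_iff.1 hE
    let φ' := e.symm.toMonoidHom.comp φ
    have hφ : e.toMonoidHom.comp φ' = φ := by ext; simp [φ']
    refine ⟨Quotient.mk _ ⟨φ'.range, φ', rfl⟩, Quotient.sound ?_⟩
    -- The chosen homomorphism may differ from `φ'`, but it has the same range, so conjugation by
    -- `1` suffices.
    obtain ⟨i⟩ := (key (Exists.choose (⟨φ', rfl⟩ : ∃ ψ : Q →* A, ψ.range = φ'.range)) φ').2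
      ⟨1, by rw [Exists.choose_spec (⟨φ', rfl⟩ : ∃ ψ : Q →* A, ψ.range = φ'.range)]; ext; simp⟩
    rw [hφ] at i
    exact ⟨i.trans f⟩


/-! ### Commutative groups: torsion splitting, complements, and homomorphisms with equal image -/

theorem isCompl_ker_powMonoidHom {K : Type*} [CommGroup K] {c d : ℕ} (hcd : c.Coprime d)
    (hK : ∀ x : K, x ^ (c * d) = 1) :
    IsCompl (powMonoidHom c : K →* K).ker (powMonoidHom d : K →* K).ker := by
  constructor
  · rw [Subgroup.disjoint_def]
    intro x hx hy
    simp only [MonoidHom.mem_ker, powMonoidHom_apply] at hx hy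
    rw [← orderOf_eq_one_iff]
    exact Nat.eq_one_of_dvd_coprimes hcd (orderOf_dvd_of_pow_eq_one hx)
      (orderOf_dvd_of_pow_eq_one hy)
  · rw [codisjoint_iff, eq_top_iff]
    intro x _
    have hb := Nat.gcd_eq_gcd_ab c d
    rw [hcd.gcd_eq_one] at hb
    have h1 (i : ℤ) (n : ℕ) : (x ^ i) ^ n = x ^ (i * n) := by rw [zpow_mul, zpow_natCast]
    have hx : x ^ ((c : ℤ) * d) = 1 := by exact_mod_cast hK x
    rw [Subgroup.mem_sup]
    -- Bézout: the two exponents add up to `1`, the first is a multiple of `d` and the second a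
    -- multiple of `c`.
    refine ⟨x ^ ((d : ℤ) * c.gcdB d), ?_, x ^ ((c : ℤ) * c.gcdA d), ?_, ?_⟩
    · rw [MonoidHom.mem_ker, powMonoidHom_apply, h1,
        show (d : ℤ) * c.gcdB d * c = c * d * c.gcdB d by ring, zpow_mul, hx, one_zpow]
    · rw [MonoidHom.mem_ker, powMonoidHom_apply, h1,
        show (c : ℤ) * c.gcdA d * d = c * d * c.gcdA d by ring, zpow_mul, hx, one_zpow]
    · rw [← zpow_add, add_comm, ← hb]
      simp

/-- A commutative group is the direct product of two complementary subgroups. -/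
noncomputable def Subgroup.prodMulEquivOfIsCompl {K : Type*} [CommGroup K] {H P : Subgroup K}
    (h : IsCompl H P) : H × P ≃* K :=
  MulEquiv.ofBijective (H.subtype.coprod P.subtype) <| by
    constructor
    · rw [injective_iff_map_eq_one]
      rintro ⟨⟨x, hx⟩, ⟨y, hy⟩⟩ hxy
      have hxy' : x * y = 1 := by simpa using hxy
      have hx1 : x = 1 := (Subgroup.disjoint_def.1 h.disjoint) hx
        (by rw [eq_inv_of_mul_eq_one_left hxy']; exact inv_mem hy)
      subst hx1
      rw [one_mul] at hxy'
      subst hxy'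
      rfl
    · intro x
      have hx : x ∈ H ⊔ P := by rw [h.sup_eq_top]; trivial
      obtain ⟨y, hy, z, hz, rfl⟩ := Subgroup.mem_sup.1 hx
      exact ⟨(⟨y, hy⟩, ⟨z, hz⟩), by simp⟩

@[simp] theorem Subgroup.prodMulEquivOfIsCompl_apply {K : Type*} [CommGroup K] {H P : Subgroup K}
    (h : IsCompl H P) (x : H × P) : prodMulEquivOfIsCompl h x = x.1 * x.2 := rfl

/-- For square-free `d` the ring `ZMod d` is Artinian and reduced, hence semisimple. This is the
source of all complements below. -/
theorem isSemisimpleModule_zmod_of_squarefree {d : ℕ} (hd : Squarefree d) {M : Type*}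
    [AddCommGroup M] [Module (ZMod d) M] : IsSemisimpleModule (ZMod d) M := by
  have : NeZero d := ⟨hd.ne_zero⟩
  have : Fact (Squarefree d) := ⟨hd⟩
  have : IsSemisimpleRing (ZMod d) := IsArtinianRing.isSemisimpleRing_of_isReduced _
  infer_instance

theorem exists_isCompl_addSubgroup_of_squarefree {d : ℕ} (hd : Squarefree d) {M : Type*}
    [AddCommGroup M] (hM : ∀ x : M, d • x = 0) (H : AddSubgroup M) :
    ∃ P : AddSubgroup M, IsCompl H P := by
  let _ : Module (ZMod d) M := AddCommGroup.zmodModule hM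
  have := isSemisimpleModule_zmod_of_squarefree hd (M := M)
  obtain ⟨P, hP⟩ := this.toComplementedLattice.exists_isCompl (AddSubgroup.toZModSubmodule d H)
  exact ⟨_, (OrderIso.isCompl_iff (AddSubgroup.toZModSubmodule d)).2
    (by rwa [OrderIso.apply_symm_apply])⟩

theorem exists_isCompl_subgroup_of_squarefree {E : Type*} [CommGroup E] {d : ℕ}
    (hd : Squarefree d) (hE : ∀ x : E, x ^ d = 1) (H : Subgroup E) :
    ∃ P : Subgroup E, IsCompl H P := by
  obtain ⟨P, hP⟩ := exists_isCompl_addSubgroup_of_squarefree hd (M := Additive E)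
    (fun x => hE x.toMul) H.toAddSubgroup
  exact ⟨_, (OrderIso.isCompl_iff Subgroup.toAddSubgroup).2 (by rwa [OrderIso.apply_symm_apply])⟩

/-- A finite commutative group of square-free exponent whose order divides the square of the
exponent bound is a product of at most two cyclic groups. -/
theorem exists_mulEquiv_cyc_prod_cyc {E : Type*} [CommGroup E] [Finite E] {d : ℕ}
    (hd : Squarefree d) (hE : ∀ x : E, x ^ d = 1) (hcard : Nat.card E ∣ d * d) :
    ∃ b e : ℕ, b ∣ d ∧ e ∣ b ∧ Nonempty (E ≃* Cyc b × Cyc e) := by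
  obtain ⟨x, hx⟩ := Monoid.exists_orderOf_eq_exponent (Monoid.ExponentExists.of_finite (G := E))
  obtain ⟨P, hP⟩ := exists_isCompl_subgroup_of_squarefree hd hE (Subgroup.zpowers x)
  have hbd : Monoid.exponent E ∣ d := Monoid.exponent_dvd_of_forall_pow_eq_one hE
  have hcE : Nat.card E = Monoid.exponent E * Nat.card P := by
    rw [← Nat.card_congr (Subgroup.prodMulEquivOfIsCompl hP).toEquiv, Nat.card_prod,
      Nat.card_zpowers, hx]
  have hprime : ∀ r : ℕ, r.Prime → r ∣ Nat.card E → r ∣ Monoid.exponent E := fun r hr h => by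
    have := Fact.mk hr
    obtain ⟨y, hy⟩ := exists_prime_orderOf_dvd_card' r h
    exact hy ▸ Monoid.order_dvd_exponent y
  -- Write `d = b * b'` with `b` the exponent. By Cauchy every prime dividing `|P|` divides `b`,
  -- hence not `b'`, since `d` is square-free. Then `b * |P| ∣ d * d` leaves `|P| ∣ b`.
  have hPE : Nat.card P ∣ Monoid.exponent E := by
    obtain ⟨b', hb'⟩ := hbd
    have hcop : (Nat.card P).Coprime b' := by
      refine Nat.Coprime.symm (Nat.coprime_of_dvd fun r hr hr1 hr2 => ?_)
      have h3 := hprime r hr (hcE ▸ hr2.mul_left _)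
      exact hr.one_lt.ne' (Nat.isUnit_iff.1 (hd r (hb' ▸ mul_dvd_mul h3 hr1)))
    have hpos : 0 < Monoid.exponent E := Nat.pos_of_ne_zero Monoid.exponent_ne_zero_of_finite
    rw [hcE, hb', mul_assoc, mul_dvd_mul_iff_left hpos.ne'] at hcard
    rw [mul_comm b', mul_assoc] at hcard
    exact hcop.dvd_of_dvd_mul_right (hcop.dvd_of_dvd_mul_right (by rwa [mul_assoc]))
  refine ⟨Monoid.exponent E, Nat.card P, hbd, hPE, ?_⟩
  -- A commutative group of square-free order is cyclic: its Sylow subgroups are cyclic, so its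
  -- exponent equals its order.
  have : IsZGroup P := IsZGroup.of_squarefree (hd.squarefree_of_dvd (hPE.trans hbd))
  have : IsCyclic P := IsCyclic.of_exponent_eq_card (IsZGroup.exponent_eq_card P)
  have h1 := zmodCyclicMulEquiv (inferInstance : IsCyclic (Subgroup.zpowers x))
  rw [Nat.card_zpowers, hx] at h1
  exact ⟨(Subgroup.prodMulEquivOfIsCompl hP).symm.trans
    (h1.symm.prodCongr (zmodCyclicMulEquiv this).symm)⟩

/-- For a generator `z`, `f z` and `g z` generate the same group, so `f z = g z ^ u` with `u` a unit
modulo the order of `g z`. Units lift along `ZMod (Nat.card C) → ZMod (orderOf (g z))`, and the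
automorphism is the power map by a lift `v`. -/
theorem MonoidHom.exists_mulAut_of_range_eq_of_isCyclic {C A : Type*} [CommGroup C] [Finite C]
    [IsCyclic C] [Group A] (f g : C →* A) (h : f.range = g.range) :
    ∃ b : MulAut C, ∀ x, g (b x) = f x := by
  obtain ⟨z, hz⟩ := IsCyclic.exists_generator (α := C)
  have hn : orderOf z = Nat.card C := orderOf_eq_card_of_forall_mem_zpowers hz
  have : NeZero (Nat.card C) := ⟨Nat.card_pos.ne'⟩
  have hr (f : C →* A) : f.range = Subgroup.zpowers (f z) := by
    rw [← MonoidHom.map_zpowers, (Subgroup.eq_top_iff' _).2 hz, MonoidHom.range_eq_map]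
  have hgk : orderOf (g z) ∣ Nat.card C := hn ▸ orderOf_map_dvd g z
  have hfg : orderOf (f z) = orderOf (g z) := by
    rw [← Nat.card_zpowers, ← Nat.card_zpowers, ← hr, ← hr, h]
  have hpos : 0 < orderOf (g z) := Nat.pos_of_dvd_of_pos hgk Nat.card_pos
  obtain ⟨u, hu⟩ : ∃ u : ℕ, g z ^ u = f z := by
    have : f z ∈ Subgroup.zpowers (g z) := by rw [← hr, ← h]; exact ⟨z, rfl⟩
    exact (orderOf_pos_iff.1 hpos).mem_powers_iff_mem_zpowers.2 this
  have hcop : u.Coprime (orderOf (g z)) := by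
    have h1 : orderOf (g z ^ u) = orderOf (g z) / (orderOf (g z)).gcd u :=
      IsOfFinOrder.orderOf_pow _ _ (orderOf_pos_iff.1 hpos)
    rw [hu, hfg] at h1
    have h2 := Nat.div_mul_cancel (Nat.gcd_dvd_left (orderOf (g z)) u)
    rw [← h1] at h2
    rw [Nat.Coprime, Nat.gcd_comm]
    exact Nat.eq_of_mul_eq_mul_left hpos (by rw [h2, mul_one])
  obtain ⟨v, hv⟩ := ZMod.unitsMap_surjective hgk (ZMod.unitOfCoprime u hcop)
  have hw : (Nat.card C).Coprime (v : ZMod (Nat.card C)).val := (ZMod.val_coe_unit_coprime v).symm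
  have hmod : (v : ZMod (Nat.card C)).val ≡ u [MOD orderOf (g z)] := by
    rw [← ZMod.natCast_eq_natCast_iff]
    have := congrArg Units.val hv
    rw [ZMod.unitsMap_val, ZMod.coe_unitOfCoprime] at this
    rw [← this, ZMod.natCast_val]
  refine ⟨{ powCoprime hw with map_mul' := fun x y => mul_pow x y _ }, fun x => ?_⟩
  change g (x ^ (v : ZMod (Nat.card C)).val) = f x
  obtain ⟨j, rfl⟩ := Subgroup.mem_zpowers_iff.1 (hz x)
  rw [map_pow, map_zpow, map_zpow, ← hu, ← pow_eq_pow_iff_modEq.2 hmod, ← zpow_natCast,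
    ← zpow_natCast, zpow_comm]

/-- Each kernel has a complement, which maps isomorphically onto the common range. An isomorphism
between the kernels is glued to the isomorphism of complements that this range provides. -/
theorem MonoidHom.exists_mulAut_of_range_eq_of_squarefree {E A : Type*} [CommGroup E] [Group A]
    {d : ℕ} (hd : Squarefree d) (hE : ∀ x : E, x ^ d = 1) (f g : E →* A) (h : f.range = g.range)
    (hker : Nonempty (f.ker ≃* g.ker)) :
    ∃ b : MulAut E, ∀ x, g (b x) = f x := by
  have key (f : E →* A) : ∃ (P : Subgroup E) (hP : IsCompl f.ker P) (η : P ≃* f.range),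
      ∀ x, (η x : A) = f x := by
    obtain ⟨P, hP⟩ := exists_isCompl_subgroup_of_squarefree hd hE f.ker
    refine ⟨P, hP, MulEquiv.ofBijective (f.rangeRestrict.comp P.subtype) ⟨?_, ?_⟩, fun x => rfl⟩
    · rw [injective_iff_map_eq_one]
      rintro ⟨x, hx⟩ h
      have : f x = 1 := congrArg Subtype.val h
      exact Subtype.ext ((Subgroup.disjoint_def.1 hP.disjoint) this hx)
    · rintro ⟨_, x, rfl⟩
      obtain ⟨⟨⟨y, hy⟩, z⟩, rfl⟩ := (Subgroup.prodMulEquivOfIsCompl hP).surjective x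
      refine ⟨z, Subtype.ext ?_⟩
      rw [MonoidHom.mem_ker] at hy
      simp [hy]
  obtain ⟨θ⟩ := hker
  obtain ⟨P, hP, η, hη⟩ := key f
  obtain ⟨P', hP', η', hη'⟩ := key g
  let i : P ≃* P' := (η.trans (MulEquiv.subgroupCongr h)).trans η'.symm
  refine ⟨((Subgroup.prodMulEquivOfIsCompl hP).symm.trans (θ.prodCongr i)).trans
    (Subgroup.prodMulEquivOfIsCompl hP'), fun x => ?_⟩
  obtain ⟨⟨⟨y, hy⟩, z⟩, rfl⟩ := (Subgroup.prodMulEquivOfIsCompl hP).surjective x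
  have h1 : g (i z) = f z := by
    rw [← hη', ← hη]
    simp [i]
  have h2 : g (θ ⟨y, hy⟩) = 1 := (θ ⟨y, hy⟩).2
  rw [MulEquiv.trans_apply, MulEquiv.trans_apply, MulEquiv.symm_apply_apply,
    Subgroup.prodMulEquivOfIsCompl_apply, Subgroup.prodMulEquivOfIsCompl_apply, map_mul, map_mul]
  refine (congrArg₂ (· * ·) h2 h1).trans ?_
  rw [show f y = 1 from hy]


/-! ### Subgroups and images of `Q` as products of cyclic groups -/

/-- `K` is a product of cyclic groups of orders `a ∣ c` and `e ∣ b ∣ d`. -/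
def HasCycDecomposition (c d : ℕ) (K : Type*) [Group K] : Prop :=
  ∃ a b e : ℕ, a ∣ c ∧ b ∣ d ∧ e ∣ b ∧ Nonempty (K ≃* Cyc a × (Cyc b × Cyc e))

theorem HasCycDecomposition.congr {c d : ℕ} {K L : Type*} [Group K] [Group L]
    (h : HasCycDecomposition c d K) (i : K ≃* L) : HasCycDecomposition c d L := by
  obtain ⟨a, b, e, ha, hb, he, ⟨j⟩⟩ := h
  exact ⟨a, b, e, ha, hb, he, ⟨i.symm.trans j⟩⟩

theorem card_cyc (n : ℕ) : Nat.card (Cyc n) = n := Nat.card_zmod n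

theorem hasCycDecomposition_of_ker_pow {K : Type*} [CommGroup K] [Finite K] {c d : ℕ}
    (hcd : c.Coprime d) (hd : Squarefree d) (hK : ∀ x : K, x ^ (c * d) = 1)
    (h1 : IsCyclic (powMonoidHom c : K →* K).ker)
    (h2 : Nat.card (powMonoidHom d : K →* K).ker ∣ d * d) : HasCycDecomposition c d K := by
  obtain ⟨b, e, hb, he, ⟨i⟩⟩ := exists_mulEquiv_cyc_prod_cyc hd
    (fun x : (powMonoidHom d : K →* K).ker => Subtype.ext x.2) h2
  refine ⟨_, b, e, ?_, hb, he, ⟨(Subgroup.prodMulEquivOfIsCompl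
    (isCompl_ker_powMonoidHom hcd hK)).symm.trans ((zmodCyclicMulEquiv h1).symm.prodCongr i)⟩⟩
  rw [← h1.exponent_eq_card]
  exact Monoid.exponent_dvd_of_forall_pow_eq_one fun x => Subtype.ext x.2

theorem eq_one_of_pow_eq_one_of_coprime {M : Type*} [Monoid M] {c d : ℕ} (hcd : c.Coprime d)
    {x : M} (hc : x ^ c = 1) (hd : x ^ d = 1) : x = 1 :=
  orderOf_eq_one_iff.1 (Nat.eq_one_of_dvd_coprimes hcd (orderOf_dvd_of_pow_eq_one hc)
    (orderOf_dvd_of_pow_eq_one hd))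

theorem MonoidHom.range_comp_of_surjective {G H K : Type*} [Group G] [Group H] [Group K]
    (f : H →* K) (g : G →* H) (hg : Function.Surjective g) : (f.comp g).range = f.range := by
  rw [MonoidHom.range_comp, MonoidHom.range_eq_top.2 hg, MonoidHom.range_eq_map]

section Coprime

variable {C E K A : Type*} [CommGroup C] [CommGroup E] [CommGroup K] [Group A] {c d : ℕ}

theorem Prod.pow_mul_eq_one (hC : ∀ x : C, x ^ c = 1) (hE : ∀ y : E, y ^ d = 1) (z : C × E) :
    z ^ (c * d) = 1 := by
  ext
  · simp [pow_mul, hC]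
  · simp [mul_comm c d, pow_mul, hE]

/-- Coprimality of `c` and `d` makes the projection to `C` injective on the `c`-torsion of `K`, and
the projection to `E` injective on its `d`-torsion. -/
theorem hasCycDecomposition_of_injective [Finite C] [IsCyclic C] [Finite E] (hcd : c.Coprime d)
    (hd : Squarefree d) (hC : ∀ x : C, x ^ c = 1) (hE : ∀ y : E, y ^ d = 1)
    (hcard : Nat.card E ∣ d * d) (ι : K →* C × E) (hι : Function.Injective ι) :
    HasCycDecomposition c d K := by
  have : Finite K := Finite.of_injective ι hι
  refine hasCycDecomposition_of_ker_pow hcd hd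
    (fun x => hι (by rw [map_pow, Prod.pow_mul_eq_one hC hE, map_one])) ?_ ?_
  · refine isCyclic_of_injective
      (((MonoidHom.fst C E).comp ι).comp (powMonoidHom c : K →* K).ker.subtype)
      ((injective_iff_map_eq_one _).2 ?_)
    rintro ⟨x, hx⟩ h
    replace hx : x ^ c = 1 := hx
    refine Subtype.ext (hι ?_)
    rw [OneMemClass.coe_one, map_one]
    exact Prod.ext h (eq_one_of_pow_eq_one_of_coprime hcd
      (by rw [← Prod.pow_snd, ← map_pow, hx, map_one]; rfl) (hE _))
  · refine (Subgroup.card_dvd_of_injective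
      (((MonoidHom.snd C E).comp ι).comp (powMonoidHom d : K →* K).ker.subtype)
      ((injective_iff_map_eq_one _).2 ?_)).trans hcard
    rintro ⟨x, hx⟩ h
    replace hx : x ^ d = 1 := hx
    refine Subtype.ext (hι ?_)
    rw [OneMemClass.coe_one, map_one]
    exact Prod.ext (eq_one_of_pow_eq_one_of_coprime hcd (hC _)
      (by rw [← Prod.pow_fst, ← map_pow, hx, map_one]; rfl)) h

/-- The image of the factor `C` is recovered from the range alone, as its `c`-torsion. Homomorphisms
with equal range therefore have equal images on each factor and can be compared factor by factor. -/
theorem MonoidHom.mem_range_comp_inl_iff (hcd : c.Coprime d) (hC : ∀ x : C, x ^ c = 1)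
    (hE : ∀ y : E, y ^ d = 1) (f : C × E →* A) (x : A) :
    x ∈ (f.comp (MonoidHom.inl C E)).range ↔ x ∈ f.range ∧ x ^ c = 1 := by
  constructor
  · rintro ⟨u, rfl⟩
    refine ⟨⟨_, rfl⟩, ?_⟩
    rw [← map_pow, hC, map_one]
  · rintro ⟨⟨⟨u, v⟩, rfl⟩, h⟩
    have huv : (u, v) = (u, 1) * (1, v) := by simp
    have h1 : f (1, v) = 1 := by
      apply eq_one_of_pow_eq_one_of_coprime hcd
      · rw [huv, map_mul, Commute.mul_pow (((Commute.one_right u).prod (Commute.one_left v)).map f),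
          ← map_pow, show ((u, 1) : C × E) ^ c = 1 from Prod.ext (hC u) (one_pow c), map_one,
          one_mul] at h
        exact h
      · rw [← map_pow, show ((1, v) : C × E) ^ d = 1 from Prod.ext (one_pow d) (hE v), map_one]
    refine ⟨u, ?_⟩
    rw [huv, map_mul, h1, mul_one]
    rfl

theorem MonoidHom.mem_range_comp_inr_iff (hcd : c.Coprime d) (hC : ∀ x : C, x ^ c = 1)
    (hE : ∀ y : E, y ^ d = 1) (f : C × E →* A) (x : A) :
    x ∈ (f.comp (MonoidHom.inr C E)).range ↔ x ∈ f.range ∧ x ^ d = 1 := by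
  have h := mem_range_comp_inl_iff hcd.symm hE hC
    (f.comp (MulEquiv.prodComm : E × C ≃* C × E).toMonoidHom) x
  rw [MonoidHom.range_comp_of_surjective f _ (MulEquiv.surjective _)] at h
  exact h

theorem hasCycDecomposition_range [Finite C] [IsCyclic C] [Finite E] (hcd : c.Coprime d)
    (hd : Squarefree d) (hC : ∀ x : C, x ^ c = 1) (hE : ∀ y : E, y ^ d = 1)
    (hcard : Nat.card E ∣ d * d) (f : C × E →* A) : HasCycDecomposition c d f.range := by
  -- The target `A` need not be commutative; the quotient by the kernel carries the commutative
  -- structure that the torsion argument requires.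
  refine HasCycDecomposition.congr ?_ (QuotientGroup.quotientKerEquivRange f)
  let π := QuotientGroup.mk' f.ker
  have hπ : π.range = ⊤ := MonoidHom.range_eq_top.2 (QuotientGroup.mk'_surjective _)
  have hc : (powMonoidHom c : _ →* (C × E) ⧸ f.ker).ker = (π.comp (MonoidHom.inl C E)).range := by
    ext x
    rw [MonoidHom.mem_range_comp_inl_iff hcd hC hE, hπ]
    simp
  have hd' : (powMonoidHom d : _ →* (C × E) ⧸ f.ker).ker = (π.comp (MonoidHom.inr C E)).range := by
    ext x
    rw [MonoidHom.mem_range_comp_inr_iff hcd hC hE, hπ]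
    simp
  refine hasCycDecomposition_of_ker_pow hcd hd ?_ ?_ ?_
  · intro x
    obtain ⟨y, rfl⟩ := QuotientGroup.mk'_surjective _ x
    rw [← map_pow, Prod.pow_mul_eq_one hC hE, map_one]
  · rw [hc]
    exact isCyclic_of_surjective _ (MonoidHom.rangeRestrict_surjective _)
  · rw [hd']
    exact (Subgroup.card_range_dvd _).trans hcard

theorem MonoidHom.exists_mulAut_prod (hcd : c.Coprime d) (hC : ∀ x : C, x ^ c = 1)
    (hE : ∀ y : E, y ^ d = 1)
    (homC : ∀ f g : C →* A, f.range = g.range → ∃ b : MulAut C, ∀ x, g (b x) = f x)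
    (homE : ∀ f g : E →* A, f.range = g.range → ∃ b : MulAut E, ∀ x, g (b x) = f x)
    (f g : C × E →* A) (h : f.range = g.range) : ∃ b : MulAut (C × E), ∀ x, g (b x) = f x := by
  obtain ⟨b₁, h₁⟩ := homC (f.comp (MonoidHom.inl C E)) (g.comp (MonoidHom.inl C E)) (by
    ext x; rw [mem_range_comp_inl_iff hcd hC hE, mem_range_comp_inl_iff hcd hC hE, h])
  obtain ⟨b₂, h₂⟩ := homE (f.comp (MonoidHom.inr C E)) (g.comp (MonoidHom.inr C E)) (by
    ext x; rw [mem_range_comp_inr_iff hcd hC hE, mem_range_comp_inr_iff hcd hC hE, h])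
  refine ⟨b₁.prodCongr b₂, ?_⟩
  rintro ⟨u, v⟩
  have h3 : (u, v) = (u, 1) * (1, v) := by simp
  have h4 : (b₁ u, b₂ v) = (b₁ u, 1) * (1, b₂ v) := by simp
  change g (b₁ u, b₂ v) = _
  rw [h3, h4, map_mul, map_mul]
  exact congrArg₂ (· * ·) (h₁ u) (h₂ v)

end Coprime

/-- The order alone recovers `a` and `b`, and then `e`. This is why groups with such a decomposition
are classified by their order. -/
theorem HasCycDecomposition.card_eq {c d : ℕ} (hcd : c.Coprime d) (hd : Squarefree d) {a b e : ℕ}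
    (ha : a ∣ c) (hb : b ∣ d) (he : e ∣ b) :
    a = (a * (b * e)).gcd c ∧ b = (a * (b * e)).gcd d := by
  have had : a.Coprime d := hcd.coprime_dvd_left ha
  have hbc : b.Coprime c := (hcd.symm).coprime_dvd_left hb
  have hec : e.Coprime c := hbc.coprime_dvd_left he
  constructor
  · rw [Nat.gcd_comm, Nat.Coprime.gcd_mul_right_cancel_right _ (hbc.mul_left hec),
      Nat.gcd_eq_right ha]
  · rw [Nat.gcd_comm, Nat.Coprime.gcd_mul_left_cancel_right _ had]
    refine Nat.dvd_antisymm (Nat.dvd_gcd hb (dvd_mul_right _ _)) ?_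
    -- This gcd divides `b * b` and is square-free, so it divides `b`.
    have hsq : Squarefree (d.gcd (b * e)) := hd.squarefree_of_dvd (Nat.gcd_dvd_left _ _)
    rw [← hsq.dvd_pow_iff_dvd two_ne_zero, sq]
    exact (Nat.gcd_dvd_right _ _).trans (mul_dvd_mul_left _ he)

theorem HasCycDecomposition.nonempty_mulEquiv {c d : ℕ} (hc : c ≠ 0) (hcd : c.Coprime d)
    (hd : Squarefree d)
    {K L : Type*} [Group K] [Group L] (hK : HasCycDecomposition c d K)
    (hL : HasCycDecomposition c d L) (h : Nat.card K = Nat.card L) : Nonempty (K ≃* L) := by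
  obtain ⟨a, b, e, ha, hb, he, ⟨i⟩⟩ := hK
  obtain ⟨a', b', e', ha', hb', he', ⟨j⟩⟩ := hL
  rw [Nat.card_congr i.toEquiv, Nat.card_congr j.toEquiv] at h
  simp only [Nat.card_prod, card_cyc] at h
  obtain ⟨h1, h2⟩ := HasCycDecomposition.card_eq hcd hd ha hb he
  obtain ⟨h1', h2'⟩ := HasCycDecomposition.card_eq hcd hd ha' hb' he'
  obtain rfl : a = a' := by rw [h1, h1', h]
  obtain rfl : b = b' := by rw [h2, h2', h]
  have ha0 : 0 < a := Nat.pos_of_dvd_of_pos ha (Nat.pos_of_ne_zero hc)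
  have hb0 : 0 < b := Nat.pos_of_dvd_of_pos hb (Nat.pos_of_ne_zero hd.ne_zero)
  obtain rfl : e = e' := Nat.eq_of_mul_eq_mul_left hb0 (Nat.eq_of_mul_eq_mul_left ha0 h)
  exact ⟨i.trans j.symm⟩

theorem exists_cyc_surjective {m n : ℕ} (h : m ∣ n) :
    ∃ f : Cyc n →* Cyc m, Function.Surjective f :=
  ⟨AddMonoidHom.toMultiplicative (ZMod.castHom h (ZMod m)).toAddMonoidHom,
    ZMod.castHom_surjective h⟩

theorem HasCycDecomposition.exists_surjective {c d : ℕ} {K : Type*} [Group K]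
    (hK : HasCycDecomposition c d K) :
    ∃ f : Cyc c × (Cyc d × Cyc d) →* K, Function.Surjective f := by
  obtain ⟨a, b, e, ha, hb, he, ⟨i⟩⟩ := hK
  obtain ⟨f, hf⟩ := exists_cyc_surjective ha
  obtain ⟨g, hg⟩ := exists_cyc_surjective hb
  obtain ⟨h, hh⟩ := exists_cyc_surjective (he.trans hb)
  exact ⟨i.symm.toMonoidHom.comp (f.prodMap (g.prodMap h)),
    i.symm.surjective.comp (hf.prodMap (hg.prodMap hh))⟩

/-- Group the order as `(a * b) * e`: the coprime `a` and `b` divide `n`, hence so do `a * b` and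
`e`. With `n = p - 1` the bound is `l * m`. -/
theorem HasCycDecomposition.card_dvd {c d n : ℕ} {K : Type*} [Group K] (hcd : c.Coprime d)
    (hK : HasCycDecomposition c d K) (h : ∀ x : K, x ^ n = 1) :
    Nat.card K ∣ (c * d).gcd n * d.gcd n := by
  obtain ⟨a, b, e, ha, hb, he, ⟨i⟩⟩ := hK
  have h' (z : Cyc a × (Cyc b × Cyc e)) : z ^ n = 1 := i.symm.injective (by
    rw [map_pow, h, map_one])
  have key (k : ℕ) (f : Cyc k →* Cyc a × (Cyc b × Cyc e)) (hf : Function.Injective f) :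
      k ∣ n := by
    have := Monoid.exponent_dvd_of_forall_pow_eq_one (G := Cyc k) (n := n)
      fun x => hf (by rw [map_pow, h', map_one])
    rwa [IsCyclic.exponent_eq_card, card_cyc] at this
  have han : a ∣ n := key a (MonoidHom.inl _ _) (fun x y h => by simpa using h)
  have hbn : b ∣ n := key b ((MonoidHom.inr _ _).comp (MonoidHom.inl _ _))
    (fun x y h => by simpa using h)
  rw [Nat.card_congr i.toEquiv]
  simp only [Nat.card_prod, card_cyc]
  rw [← mul_assoc]
  have hab : a.Coprime b := (hcd.coprime_dvd_left ha).coprime_dvd_right hb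
  exact mul_dvd_mul (Nat.dvd_gcd (mul_dvd_mul ha hb) (hab.mul_dvd_of_dvd_of_dvd han hbn))
    (Nat.dvd_gcd (he.trans hb) (he.trans hbn))

/-- The Chinese remainder decomposition of `Cyc (c * d) × Cyc d`. -/
def cycProdEquiv {c d : ℕ} (hcd : c.Coprime d) :
    Cyc (c * d) × Cyc d ≃* Cyc c × (Cyc d × Cyc d) :=
  ((MulEquiv.prodCongr ((AddEquiv.toMultiplicative
    (ZMod.chineseRemainder hcd).toAddEquiv).trans (MulEquiv.prodMultiplicative _ _))
      (MulEquiv.refl _))).trans MulEquiv.prodAssoc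

theorem cyc_pow_eq_one (n : ℕ) (x : Cyc n) : x ^ n = 1 := by
  simpa only [card_cyc] using pow_card_eq_one' (x := x)

theorem cyc_prod_pow_eq_one (n : ℕ) (x : Cyc n × Cyc n) : x ^ n = 1 :=
  Prod.ext (cyc_pow_eq_one n _) (cyc_pow_eq_one n _)

theorem card_cyc_prod_dvd (n : ℕ) : Nat.card (Cyc n × Cyc n) ∣ n * n := by
  rw [Nat.card_prod, card_cyc]

theorem hasCycDecomposition_subgroup {c d : ℕ} (hc : c ≠ 0) (hcd : c.Coprime d)
    (hd : Squarefree d) (H : Subgroup (Cyc (c * d) × Cyc d)) :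
    HasCycDecomposition c d H := by
  have := NeZero.mk hc
  have := NeZero.mk hd.ne_zero
  exact hasCycDecomposition_of_injective hcd hd (cyc_pow_eq_one c) (cyc_prod_pow_eq_one d)
    (card_cyc_prod_dvd d) ((cycProdEquiv hcd).toMonoidHom.comp H.subtype)
    ((cycProdEquiv hcd).injective.comp H.subtype_injective)

theorem exists_range_eq_iff_hasCycDecomposition {c d : ℕ} (hc : c ≠ 0) (hcd : c.Coprime d)
    (hd : Squarefree d) {A : Type*} [Group A] (K : Subgroup A) :
    (∃ φ : Cyc (c * d) × Cyc d →* A, φ.range = K) ↔ HasCycDecomposition c d K := by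
  have := NeZero.mk hc
  have := NeZero.mk hd.ne_zero
  constructor
  · rintro ⟨φ, rfl⟩
    have h := hasCycDecomposition_range hcd hd (cyc_pow_eq_one c) (cyc_prod_pow_eq_one d)
      (card_cyc_prod_dvd d) (φ.comp (cycProdEquiv hcd).symm.toMonoidHom)
    rwa [MonoidHom.range_comp_of_surjective _ _ (MulEquiv.surjective _)] at h
  · intro h
    obtain ⟨f, hf⟩ := h.exists_surjective
    refine ⟨(K.subtype.comp f).comp (cycProdEquiv hcd).toMonoidHom, ?_⟩
    rw [MonoidHom.range_comp_of_surjective _ _ (MulEquiv.surjective _),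
      MonoidHom.range_comp_of_surjective _ _ hf, Subgroup.range_subtype]

theorem exists_mulAut_of_range_eq {c d : ℕ} (hc : c ≠ 0) (hcd : c.Coprime d)
    (hd : Squarefree d) {A : Type*} [Group A] (f g : Cyc (c * d) × Cyc d →* A)
    (h : f.range = g.range) : ∃ b : MulAut (Cyc (c * d) × Cyc d), ∀ x, g (b x) = f x := by
  have := NeZero.mk hc
  have := NeZero.mk hd.ne_zero
  let i := cycProdEquiv hcd
  obtain ⟨b, hb⟩ := MonoidHom.exists_mulAut_prod hcd (cyc_pow_eq_one c) (cyc_prod_pow_eq_one d)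
    MonoidHom.exists_mulAut_of_range_eq_of_isCyclic (fun f g h =>
      MonoidHom.exists_mulAut_of_range_eq_of_squarefree hd (cyc_prod_pow_eq_one d) f g h <| by
        -- Equal ranges give kernels of equal order, and for subgroups of `Cyc d × Cyc d` the order
        -- determines the isomorphism type.
        have hk (f : Cyc d × Cyc d →* A) : HasCycDecomposition c d f.ker :=
          hasCycDecomposition_of_injective hcd hd (cyc_pow_eq_one c) (cyc_prod_pow_eq_one d)
            (card_cyc_prod_dvd d) ((MonoidHom.inr _ _).comp f.ker.subtype)
            (fun x y h => Subtype.ext (by simpa using h))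
        refine (hk f).nonempty_mulEquiv hc hcd hd (hk g) ?_
        have hf := f.ker.card_mul_index
        have hg := g.ker.card_mul_index
        rw [Subgroup.index_ker] at hf hg
        rw [h, ← hg] at hf
        have : Finite g.range := Set.finite_range g
        exact Nat.eq_of_mul_eq_mul_right Nat.card_pos hf)
    (f.comp i.symm.toMonoidHom) (g.comp i.symm.toMonoidHom) (by
      rwa [MonoidHom.range_comp_of_surjective _ _ (MulEquiv.surjective _),
        MonoidHom.range_comp_of_surjective _ _ (MulEquiv.surjective _)])
  exact ⟨(i.trans b).trans i.symm, fun x => by simpa using hb (i x)⟩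

theorem IsCyclic.exists_subgroup_card_eq {G : Type*} [Group G] [Finite G] [IsCyclic G] {t : ℕ}
    (h : t ∣ Nat.card G) : ∃ H : Subgroup G, Nat.card H = t := by
  obtain ⟨z, hz⟩ := IsCyclic.exists_ofOrder_eq_natCard (α := G)
  refine ⟨Subgroup.zpowers (z ^ (orderOf z / t)), ?_⟩
  rw [Nat.card_zpowers, orderOf_pow_orderOf_div (orderOf_pos z).ne' (hz ▸ h)]

theorem exists_subgroup_cyc_prod_card_eq {m n t : ℕ} (hm : m ≠ 0) (hn : n ≠ 0) (h : t ∣ m * n) :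
    ∃ H : Subgroup (Cyc m × Cyc n), Nat.card H = t := by
  have := NeZero.mk hm
  have := NeZero.mk hn
  obtain ⟨u, v, hu, hv, rfl⟩ := (Nat.dvd_mul).1 h
  obtain ⟨H, hH⟩ := IsCyclic.exists_subgroup_card_eq (G := Cyc m) (t := u) (by rwa [card_cyc])
  obtain ⟨K, hK⟩ := IsCyclic.exists_subgroup_card_eq (G := Cyc n) (t := v) (by rwa [card_cyc])
  exact ⟨H.prod K, by rw [Nat.card_congr (H.prodEquiv K).toEquiv, Nat.card_prod, hH, hK]⟩

/-! ### Reducible subgroups of `GL(2, p)` -/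

open Polynomial in
theorem Matrix.isRoot_charpoly_iff {n F : Type*} [Fintype n] [DecidableEq n] [Field F]
    (M : Matrix n n F) (χ : F) : M.charpoly.IsRoot χ ↔ ∃ v ≠ 0, M.mulVec v = χ • v := by
  rw [Polynomial.IsRoot, Matrix.eval_charpoly, ← Matrix.exists_mulVec_eq_zero_iff]
  simp only [Matrix.sub_mulVec, Matrix.scalar_apply, Matrix.diagonal_const_mulVec, sub_eq_zero,
    eq_comm]

theorem IsReducibleSubgroup.exists_isRoot_charpoly {p : ℕ} [Fact p.Prime]
    {K : Subgroup (GL (Fin 2) (ZMod p))} (hK : IsReducibleSubgroup K)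
    {g : GL (Fin 2) (ZMod p)} (hg : g ∈ K) :
    ∃ χ, (g : Matrix (Fin 2) (Fin 2) (ZMod p)).charpoly.IsRoot χ := by
  obtain ⟨W, hbot, htop, hW⟩ := hK
  obtain ⟨v, hv, hv0⟩ := (Submodule.ne_bot_iff W).1 hbot
  have h1 : Module.finrank (ZMod p) W < 2 := by
    simpa using Submodule.finrank_lt htop
  have h2 : Module.finrank (ZMod p) W ≠ 0 := fun h => hbot (Submodule.finrank_eq_zero.1 h)
  have h3 : Module.finrank (ZMod p) W = 1 := by lia
  have hv0' : (⟨v, hv⟩ : W) ≠ 0 := fun h => hv0 (congrArg Subtype.val h)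
  obtain ⟨χ, hχ⟩ := (finrank_eq_one_iff_of_nonzero' _ hv0').1 h3 ⟨_, hW g hg v hv⟩
  exact ⟨χ, (Matrix.isRoot_charpoly_iff _ _).2 ⟨v, hv0, (congrArg Subtype.val hχ).symm⟩⟩

theorem isReducibleSubgroup_zpowers {p : ℕ} [Fact p.Prime] {g : GL (Fin 2) (ZMod p)} {χ : ZMod p}
    (h : (g : Matrix (Fin 2) (Fin 2) (ZMod p)).charpoly.IsRoot χ) :
    IsReducibleSubgroup (Subgroup.zpowers g) := by
  obtain ⟨v, hv, hgv⟩ := (Matrix.isRoot_charpoly_iff _ _).1 h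
  refine ⟨Submodule.span _ {v}, by simpa using hv, fun ht => ?_, fun x hx w hw => ?_⟩
  · have h1 := finrank_span_singleton (K := ZMod p) hv
    rw [ht, finrank_top] at h1
    simp at h1
  · obtain ⟨a, rfl⟩ := Submodule.mem_span_singleton.1 hw
    obtain ⟨n, rfl⟩ := (isOfFinOrder_of_finite g).mem_powers_iff_mem_zpowers.2 hx
    rw [Matrix.mulVec_smul]
    refine Submodule.smul_mem _ _ ?_
    clear hx hw
    induction n with
    | zero => simp
    | succ n ih =>
      obtain ⟨b, hb⟩ := Submodule.mem_span_singleton.1 ih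
      simp only at hb ⊢
      rw [pow_succ', Units.val_mul, ← Matrix.mulVec_mulVec, ← hb, Matrix.mulVec_smul, hgv]
      exact Submodule.smul_mem _ _ (Submodule.smul_mem _ _ (Submodule.mem_span_singleton_self v))

open Polynomial in
theorem ZMod.X_sub_C_dvd_X_pow_sub_one {p : ℕ} [Fact p.Prime] {χ : ZMod p} (hχ : χ ≠ 0) :
    (X - C χ) ∣ (X ^ (p - 1) - 1 : (ZMod p)[X]) := by
  rw [Polynomial.dvd_iff_isRoot]
  simp [ZMod.pow_card_sub_one_eq_one hχ]

-- One eigenvalue in `ZMod p` forces the other. Both are nonzero, so the characteristic polynomial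
-- divides `(X ^ (p - 1) - 1) ^ 2`, which divides `(X ^ (p - 1) - 1) ^ p = X ^ ((p - 1) * p) - 1`;
-- Cayley–Hamilton concludes. The factor `p` in the exponent allows for a unipotent part.
open Polynomial in
theorem Matrix.pow_eq_one_of_isRoot_charpoly {p : ℕ} [Fact p.Prime] {g : GL (Fin 2) (ZMod p)}
    {χ : ZMod p} (h : (g : Matrix (Fin 2) (Fin 2) (ZMod p)).charpoly.IsRoot χ) :
    g ^ ((p - 1) * p) = 1 := by
  set M : Matrix (Fin 2) (Fin 2) (ZMod p) := g.val with hM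
  have hdet : M.det ≠ 0 := (Matrix.isUnit_iff_isUnit_det M).1 g.isUnit |>.ne_zero
  rw [Polynomial.IsRoot, Matrix.charpoly_fin_two] at h
  simp only [eval_add, eval_sub, eval_pow, eval_X, eval_mul, eval_C] at h
  have hprod : χ * (M.trace - χ) = M.det := by linear_combination -h
  have hfac : M.charpoly = (X - C χ) * (X - C (M.trace - χ)) := by
    rw [Matrix.charpoly_fin_two, ← hprod]
    simp only [C_mul, C_sub]
    ring
  have hdvd : M.charpoly ∣ (X ^ ((p - 1) * p) - 1 : (ZMod p)[X]) := by
    rw [pow_mul, show ((X ^ (p - 1)) ^ p - 1 : (ZMod p)[X]) = (X ^ (p - 1) - 1) ^ p by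
      rw [sub_pow_char, one_pow]]
    refine dvd_trans ?_ (pow_dvd_pow _ (Fact.out : p.Prime).two_le)
    rw [hfac, sq]
    exact mul_dvd_mul (ZMod.X_sub_C_dvd_X_pow_sub_one (left_ne_zero_of_mul (hprod ▸ hdet)))
      (ZMod.X_sub_C_dvd_X_pow_sub_one (right_ne_zero_of_mul (hprod ▸ hdet)))
  obtain ⟨q, hq⟩ := hdvd
  have h0 := congrArg (Polynomial.aeval M) hq
  rw [map_mul, Matrix.aeval_self_charpoly, zero_mul] at h0
  ext1
  simpa [sub_eq_zero, ← hM] using h0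

theorem IsReducibleSubgroup.pow_eq_one {p : ℕ} [Fact p.Prime]
    {K : Subgroup (GL (Fin 2) (ZMod p))} (hK : IsReducibleSubgroup K)
    (hcop : (Nat.card K).Coprime p) (x : K) : x ^ (p - 1) = 1 := by
  obtain ⟨χ, hχ⟩ := hK.exists_isRoot_charpoly x.2
  have h1 : x ^ ((p - 1) * p) = 1 := Subtype.ext (Matrix.pow_eq_one_of_isRoot_charpoly hχ)
  rw [pow_mul] at h1
  exact eq_one_of_pow_eq_one_of_coprime hcop pow_card_eq_one' h1

theorem IsReducibleSubgroup.map_conj {p : ℕ} {K : Subgroup (GL (Fin 2) (ZMod p))}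
    (hK : IsReducibleSubgroup K) (g : GL (Fin 2) (ZMod p)) :
    IsReducibleSubgroup (K.map (MulAut.conj g).toMonoidHom) := by
  obtain ⟨W, hbot, htop, hW⟩ := hK
  let e : (Fin 2 → ZMod p) ≃ₗ[ZMod p] (Fin 2 → ZMod p) :=
    LinearMap.GeneralLinearGroup.generalLinearEquiv _ _ (Matrix.GeneralLinearGroup.toLin g)
  have he (v : Fin 2 → ZMod p) : e v = (g : Matrix (Fin 2) (Fin 2) (ZMod p)).mulVec v := rfl
  refine ⟨W.map e.toLinearMap, ?_, ?_, ?_⟩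
  · exact fun h => hbot (Submodule.map_injective_of_injective e.injective (by simpa using h))
  · exact fun h => htop (Submodule.map_injective_of_injective e.injective (by simpa using h))
  · rintro _ ⟨x, hx, rfl⟩ _ ⟨v, hv, rfl⟩
    refine ⟨(x : Matrix (Fin 2) (Fin 2) (ZMod p)).mulVec v, hW x hx v hv, ?_⟩
    simp only [LinearEquiv.coe_coe, he, Matrix.mulVec_mulVec, ← Units.val_mul,
      MulEquiv.coe_toMonoidHom, MulAut.conj_apply, inv_mul_cancel_right]

/-! ### Irreducible commutative subgroups of `GL(2, p)` -/

section Irreducible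

open Polynomial

variable {p : ℕ} [Fact p.Prime]

open scoped IsMulCommutative in
/-- A commutative irreducible subgroup of `GL(2, p)` is cyclic. -/
theorem isCyclic_of_not_isReducibleSubgroup {K : Subgroup (GL (Fin 2) (ZMod p))}
    (hcomm : ∀ x ∈ K, ∀ y ∈ K, x * y = y * x) (hK : ¬ IsReducibleSubgroup K) : IsCyclic K := by
  let S : Set (Matrix (Fin 2) (Fin 2) (ZMod p)) := Units.val '' (K : Set (GL (Fin 2) (ZMod p)))
  have hS : ∀ a ∈ S, ∀ b ∈ S, a * b = b * a := by
    rintro _ ⟨x, hx, rfl⟩ _ ⟨y, hy, rfl⟩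
    exact congrArg Units.val (hcomm x hx y hy)
  have := Algebra.isMulCommutative_adjoin (ZMod p) hS
  let R := Algebra.adjoin (ZMod p) S
  have hR (x y : Matrix (Fin 2) (Fin 2) (ZMod p)) (hx : x ∈ R) (hy : y ∈ R) : x * y = y * x :=
    congrArg Subtype.val (mul_comm (⟨x, hx⟩ : R) ⟨y, hy⟩)
  -- If `x * y = 0` with both nonzero, then `ker x` is a nonzero proper subspace, invariant under
  -- `K` because `R` is commutative. So `R` is a domain, and a finite group of units in a domain is
  -- cyclic.
  have : NoZeroDivisors R := ⟨by
    rintro ⟨x, hx⟩ ⟨y, hy⟩ hxy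
    have hxy' : x * y = 0 := congrArg Subtype.val hxy
    by_contra! hne
    have hx0 : x ≠ 0 := fun h => hne.1 (Subtype.ext h)
    have hy0 : y ≠ 0 := fun h => hne.2 (Subtype.ext h)
    refine hK ⟨LinearMap.ker (Matrix.mulVecLin x), fun hbot => hy0 ?_, fun htop => hx0 ?_,
      fun g hg v hv => ?_⟩
    · refine Matrix.toLin'.injective (LinearMap.ext fun v => ?_)
      have : y.mulVec v ∈ LinearMap.ker (Matrix.mulVecLin x) := by
        rw [LinearMap.mem_ker, Matrix.mulVecLin_apply, Matrix.mulVec_mulVec, hxy',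
          Matrix.zero_mulVec]
      rw [hbot, Submodule.mem_bot] at this
      simpa using this
    · rw [LinearMap.ker_eq_top] at htop
      exact Matrix.toLin'.injective (htop.trans (map_zero _).symm)
    · rw [LinearMap.mem_ker, Matrix.mulVecLin_apply] at hv ⊢
      rw [Matrix.mulVec_mulVec, hR x g hx (Algebra.subset_adjoin ⟨g, hg, rfl⟩),
        ← Matrix.mulVec_mulVec, hv, Matrix.mulVec_zero]⟩
  have : IsDomain R := NoZeroDivisors.to_isDomain R
  let f : K →* R :=
    { toFun := fun x => ⟨(x : GL (Fin 2) (ZMod p)), Algebra.subset_adjoin ⟨x, x.2, rfl⟩⟩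
      map_one' := rfl
      map_mul' := fun _ _ => rfl }
  exact isCyclic_of_injective_ringHom f fun x y h =>
    Subtype.ext (Units.ext (congrArg Subtype.val h))

theorem Matrix.irreducible_charpoly_of_forall_not_isRoot {F : Type*} [Field F]
    {M : Matrix (Fin 2) (Fin 2) F} (h : ∀ χ, ¬ M.charpoly.IsRoot χ) : Irreducible M.charpoly :=
  Polynomial.irreducible_of_degree_le_three_of_not_isRoot
    (by simp [Matrix.charpoly_natDegree_eq_dim]) h

theorem Matrix.not_isRoot_of_irreducible_charpoly {F : Type*} [Field F]
    {M : Matrix (Fin 2) (Fin 2) F} (h : Irreducible M.charpoly) (χ : F) :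
    ¬ M.charpoly.IsRoot χ := fun hr => by
  have := Polynomial.degree_eq_one_of_irreducible_of_root h hr
  rw [Matrix.charpoly_degree_eq_dim] at this
  simp at this

theorem exists_generator_of_not_isReducibleSubgroup {K : Subgroup (GL (Fin 2) (ZMod p))}
    (hcomm : ∀ x ∈ K, ∀ y ∈ K, x * y = y * x) (hK : ¬ IsReducibleSubgroup K) :
    ∃ g : GL (Fin 2) (ZMod p), Subgroup.zpowers g = K ∧
      Irreducible (g : Matrix (Fin 2) (Fin 2) (ZMod p)).charpoly := by
  have := isCyclic_of_not_isReducibleSubgroup hcomm hK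
  obtain ⟨g, rfl⟩ := (Subgroup.isCyclic_iff_exists_zpowers_eq_top K).1 this
  exact ⟨g, rfl, Matrix.irreducible_charpoly_of_forall_not_isRoot
    fun χ hχ => hK (isReducibleSubgroup_zpowers hχ)⟩

/-- Two `2 × 2` matrices without eigenvectors and with the same characteristic polynomial are
similar. -/
theorem Matrix.exists_conj_of_charpoly_eq {F : Type*} [Field F] {g h : GL (Fin 2) F}
    (hg : Irreducible (g : Matrix (Fin 2) (Fin 2) F).charpoly)
    (hgh : (g : Matrix (Fin 2) (Fin 2) F).charpoly = (h : Matrix (Fin 2) (Fin 2) F).charpoly) :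
    ∃ x : GL (Fin 2) F, h = x * g * x⁻¹ := by
  have key (g : GL (Fin 2) F) (hg : Irreducible (g : Matrix (Fin 2) (Fin 2) F).charpoly) :
      ∃ x : GL (Fin 2) F, (g : Matrix (Fin 2) (Fin 2) F) * x =
        x * !![0, -(g : Matrix (Fin 2) (Fin 2) F).det; 1, (g : Matrix (Fin 2) (Fin 2) F).trace] := by
    set M : Matrix (Fin 2) (Fin 2) F := g.val
    have h10 : M 1 0 ≠ 0 := fun h0 => by
      refine Matrix.not_isRoot_of_irreducible_charpoly hg (M 0 0) ?_
      rw [Polynomial.IsRoot, Matrix.charpoly_fin_two]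
      simp only [eval_add, eval_sub, eval_pow, eval_X, eval_mul, eval_C, Matrix.trace_fin_two,
        Matrix.det_fin_two, h0]
      ring
    -- The columns are `e₁` and `M e₁`, a basis because `e₁` is not an eigenvector; in it `M`
    -- becomes its companion matrix.
    refine ⟨Matrix.GeneralLinearGroup.mkOfDetNeZero !![1, M 0 0; 0, M 1 0] ?_, ?_⟩
    · simpa [Matrix.det_fin_two] using h10
    · change M * !![1, M 0 0; 0, M 1 0] = !![1, M 0 0; 0, M 1 0] * _
      ext i j
      fin_cases i <;> fin_cases j <;>
        simp [Matrix.mul_apply, Fin.sum_univ_two, Matrix.trace_fin_two, Matrix.det_fin_two] <;> ring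
  obtain ⟨x, hx⟩ := key g hg
  obtain ⟨y, hy⟩ := key h (hgh ▸ hg)
  have hdet : (g : Matrix (Fin 2) (Fin 2) F).det = (h : Matrix (Fin 2) (Fin 2) F).det := by
    rw [Matrix.det_eq_sign_charpoly_coeff, hgh, ← Matrix.det_eq_sign_charpoly_coeff]
  have htr : (g : Matrix (Fin 2) (Fin 2) F).trace = (h : Matrix (Fin 2) (Fin 2) F).trace := by
    rw [Matrix.trace_eq_neg_charpoly_coeff, hgh, ← Matrix.trace_eq_neg_charpoly_coeff]
  rw [← hdet, ← htr] at hy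
  refine ⟨y * x⁻¹, ?_⟩
  have h1 : x⁻¹ * g * x = y⁻¹ * h * y := by
    ext1
    rw [Units.val_mul, Units.val_mul, Units.val_mul, Units.val_mul, mul_assoc, hx, mul_assoc, hy,
      ← mul_assoc, ← mul_assoc, Units.inv_mul, Units.inv_mul]
  rw [_root_.mul_inv_rev, inv_inv, show y * x⁻¹ * g * (x * y⁻¹) = y * (x⁻¹ * g * x) * y⁻¹ by group, h1]
  group

end Irreducible

section Irreducible

open Polynomial

variable {p : ℕ} [Fact p.Prime]

/-- Both elements have minimal polynomial `f`. This moves polynomial identities between a matrix and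
a root of its characteristic polynomial in a field. -/
theorem aeval_eq_zero_iff_of_irreducible {F A B : Type*} [Field F] [Ring A] [Algebra F A]
    [Nontrivial A] [Ring B] [Algebra F B] [Nontrivial B] {f : F[X]} (hf : Irreducible f)
    (hm : f.Monic) {x : A} {y : B} (hx : aeval x f = 0) (hy : aeval y f = 0) (q : F[X]) :
    aeval x q = 0 ↔ aeval y q = 0 := by
  rw [← minpoly.dvd_iff, ← minpoly.dvd_iff, ← minpoly.eq_of_irreducible_of_monic hf hx hm,
    ← minpoly.eq_of_irreducible_of_monic hf hy hm]

theorem orderOf_eq_of_irreducible {F A B : Type*} [Field F] [Ring A] [Algebra F A]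
    [Nontrivial A] [Ring B] [Algebra F B] [Nontrivial B] {f : F[X]} (hf : Irreducible f)
    (hm : f.Monic) {x : A} {y : B} (hx : aeval x f = 0) (hy : aeval y f = 0) :
    orderOf x = orderOf y := by
  rw [orderOf_eq_orderOf_iff]
  intro n
  have h := aeval_eq_zero_iff_of_irreducible hf hm hx hy (X ^ n - 1)
  rwa [map_sub, map_sub, map_pow, map_pow, aeval_X, aeval_X, map_one, map_one, sub_eq_zero,
    sub_eq_zero] at h

/-- Irreducible cyclic subgroups of `GL(2, p)` of the same order are conjugate. -/
theorem exists_conj_zpowers_of_irreducible {g h : GL (Fin 2) (ZMod p)}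
    (hg : Irreducible (g : Matrix (Fin 2) (Fin 2) (ZMod p)).charpoly)
    (hh : Irreducible (h : Matrix (Fin 2) (Fin 2) (ZMod p)).charpoly)
    (hgh : orderOf g = orderOf h) :
    ∃ x : GL (Fin 2) (ZMod p),
      Subgroup.zpowers h = (Subgroup.zpowers g).map (MulAut.conj x).toMonoidHom := by
  let L := AlgebraicClosure (ZMod p)
  set M : Matrix (Fin 2) (Fin 2) (ZMod p) := g.val with hM
  set N : Matrix (Fin 2) (Fin 2) (ZMod p) := h.val with hN
  obtain ⟨a, ha⟩ := IsAlgClosed.exists_aeval_eq_zero L M.charpoly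
    (by rw [Matrix.charpoly_degree_eq_dim]; simp)
  obtain ⟨b, hb⟩ := IsAlgClosed.exists_aeval_eq_zero L N.charpoly
    (by rw [Matrix.charpoly_degree_eq_dim]; simp)
  have hoa : orderOf a = orderOf g := by
    rw [← orderOf_units, orderOf_eq_of_irreducible hg M.charpoly_monic M.aeval_self_charpoly ha]
  have hob : orderOf b = orderOf h := by
    rw [← orderOf_units, orderOf_eq_of_irreducible hh N.charpoly_monic N.aeval_self_charpoly hb]
  have : NeZero (orderOf b) := ⟨by rw [hob]; exact (orderOf_pos h).ne'⟩
  -- In the algebraic closure, roots of unity of equal order are powers of one another. From `a = b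
  -- ^ k` it follows that `h ^ k` has the characteristic polynomial of `g`, so the two are
  -- conjugate.
  obtain ⟨k, -, hk⟩ := (IsPrimitiveRoot.orderOf b).eq_pow_of_pow_eq_one (ξ := a)
    (by rw [hob, ← hgh, ← hoa, pow_orderOf_eq_one])
  have h1 : aeval (N ^ k) M.charpoly = 0 := by
    have h2 := (aeval_eq_zero_iff_of_irreducible hh N.charpoly_monic N.aeval_self_charpoly hb
      (M.charpoly.comp (X ^ k))).2 (by simpa [aeval_comp, hk] using ha)
    simpa [aeval_comp] using h2
  have h3 : M.charpoly = (N ^ k).charpoly := by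
    rw [minpoly.eq_of_irreducible_of_monic hg h1 M.charpoly_monic]
    refine (eq_of_monic_of_dvd_of_natDegree_le (minpoly.monic (Matrix.isIntegral _))
      (Matrix.charpoly_monic _) (Matrix.minpoly_dvd_charpoly _) ?_).symm
    rw [← minpoly.eq_of_irreducible_of_monic hg h1 M.charpoly_monic,
      Matrix.charpoly_natDegree_eq_dim, Matrix.charpoly_natDegree_eq_dim]
  obtain ⟨x, hx⟩ := Matrix.exists_conj_of_charpoly_eq (g := g) (h := h ^ k) hg
    (by rw [Units.val_pow_eq_pow_val]; exact h3)
  refine ⟨x, ?_⟩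
  have h4 : (MulAut.conj x).toMonoidHom g = h ^ k := by rw [hx]; rfl
  rw [MonoidHom.map_zpowers, h4]
  symm
  refine Subgroup.eq_of_le_of_card_ge (Subgroup.zpowers_le.2 (Subgroup.npow_mem_zpowers h k)) ?_
  rw [Nat.card_zpowers, Nat.card_zpowers, ← h4, ← hgh]
  exact (orderOf_injective _ (MulAut.conj x).injective g).ge

/-- The order of `g` is that of a root of its characteristic polynomial, a nonzero element of a
field with `p ^ 2` elements. -/
theorem orderOf_dvd_of_irreducible_charpoly {g : GL (Fin 2) (ZMod p)}
    (hg : Irreducible (g : Matrix (Fin 2) (Fin 2) (ZMod p)).charpoly) :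
    orderOf g ∣ p ^ 2 - 1 := by
  set M : Matrix (Fin 2) (Fin 2) (ZMod p) := g.val with hM
  have := Fact.mk hg
  have h1 := orderOf_eq_of_irreducible hg M.charpoly_monic M.aeval_self_charpoly
    (y := AdjoinRoot.root M.charpoly) (by rw [AdjoinRoot.aeval_eq, AdjoinRoot.mk_self])
  have hcard : Nat.card (AdjoinRoot M.charpoly) = p ^ 2 := by
    have := Module.finite_of_finrank_pos (R := ZMod p) (M := AdjoinRoot M.charpoly) (by
      rw [(AdjoinRoot.powerBasis M.charpoly_monic.ne_zero).finrank, AdjoinRoot.powerBasis_dim,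
        Matrix.charpoly_natDegree_eq_dim]; simp)
    rw [Module.natCard_eq_pow_finrank (K := ZMod p),
      (AdjoinRoot.powerBasis M.charpoly_monic.ne_zero).finrank, AdjoinRoot.powerBasis_dim,
      Matrix.charpoly_natDegree_eq_dim, Nat.card_zmod, Fintype.card_fin]
  rw [← orderOf_units, h1, ← hcard]
  have : Finite (AdjoinRoot M.charpoly) := Nat.finite_of_card_ne_zero (by
    rw [hcard]; exact pow_ne_zero _ (Fact.out : p.Prime).ne_zero)
  have hroot : AdjoinRoot.root M.charpoly ≠ 0 := fun h0 => by
    rw [h0, orderOf_zero, orderOf_units] at h1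
    exact (orderOf_pos g).ne' h1
  rw [← Units.val_mk0 hroot, orderOf_units, ← Nat.card_units]
  exact orderOf_dvd_natCard _

/-- Otherwise the characteristic polynomial would divide `X ^ p - X`, which splits over `ZMod p`. -/
theorem not_orderOf_dvd_of_irreducible_charpoly {g : GL (Fin 2) (ZMod p)}
    (hg : Irreducible (g : Matrix (Fin 2) (Fin 2) (ZMod p)).charpoly) :
    ¬ orderOf g ∣ p - 1 := by
  intro h
  set M : Matrix (Fin 2) (Fin 2) (ZMod p) := g.val with hM
  have h1 : aeval M (X ^ (p - 1) - 1 : (ZMod p)[X]) = 0 := by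
    have := congrArg Units.val (orderOf_dvd_iff_pow_eq_one.1 h)
    simpa [sub_eq_zero, ← hM] using this
  rw [← minpoly.dvd_iff, ← minpoly.eq_of_irreducible_of_monic hg M.aeval_self_charpoly
    M.charpoly_monic] at h1
  have h2 : M.charpoly ∣ X ^ p - X := h1.trans ⟨X, by
    rw [sub_mul, one_mul, ← pow_succ, Nat.sub_add_cancel (Fact.out : p.Prime).one_le]⟩
  have h3 : (X ^ p - X : (ZMod p)[X]).Splits := by
    simpa using FiniteField.splits_X_pow_card_sub_X (K := ZMod p) p
  have h4 := (h3.of_dvd (FiniteField.X_pow_card_sub_X_ne_zero _ (Fact.out : p.Prime).one_lt)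
    h2).degree_eq_one_of_irreducible hg
  rw [Matrix.charpoly_degree_eq_dim] at h4
  simp at h4

/-- The witness is multiplication by an element of order `n` on the field with `p ^ 2` elements. An
eigenvalue in `ZMod p` would be that element itself, forcing `n ∣ p - 1`. -/
theorem exists_orderOf_eq_irreducible_charpoly {n : ℕ} (hn : n ∣ p ^ 2 - 1) (hn' : ¬ n ∣ p - 1) :
    ∃ g : GL (Fin 2) (ZMod p), orderOf g = n ∧
      Irreducible (g : Matrix (Fin 2) (Fin 2) (ZMod p)).charpoly := by
  let F := GaloisField p 2
  have hfin : Module.finrank (ZMod p) F = 2 := GaloisField.finrank p two_ne_zero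
  let b : Module.Basis (Fin 2) (ZMod p) F := Module.finBasisOfFinrankEq _ _ hfin
  obtain ⟨z, hz⟩ := IsCyclic.exists_ofOrder_eq_natCard (α := Fˣ)
  have hzo : orderOf z = p ^ 2 - 1 := by
    rw [hz, Nat.card_units, GaloisField.card p 2 two_ne_zero]
  obtain ⟨u, hu⟩ : ∃ u : Fˣ, orderOf u = n :=
    ⟨_, orderOf_pow_orderOf_div (orderOf_pos z).ne' (hzo ▸ hn)⟩
  let φ : Fˣ →* GL (Fin 2) (ZMod p) := Units.map (Algebra.leftMulMatrix b : F →* _)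
  have hφ : Function.Injective φ := Units.map_injective (Algebra.leftMulMatrix_injective b)
  refine ⟨φ u, by rw [orderOf_injective φ hφ, hu], ?_⟩
  refine Matrix.irreducible_charpoly_of_forall_not_isRoot fun χ hχ => hn' ?_
  obtain ⟨v, hv, h⟩ := (Matrix.isRoot_charpoly_iff _ _).1 hχ
  obtain ⟨w, rfl⟩ : ∃ w : F, b.repr w = v := ⟨b.equivFun.symm v, b.equivFun.apply_symm_apply v⟩
  have hw : w ≠ 0 := by
    rintro rfl
    simp at hv
  have h1 : (u : F) * w = χ • w := by
    apply b.repr.injective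
    ext i
    have := congrFun h i
    change ((Algebra.leftMulMatrix b u).mulVec (b.repr w)) i = _ at this
    rw [Algebra.leftMulMatrix_mulVec_repr] at this
    simpa using this
  rw [Algebra.smul_def] at h1
  have h2 : (u : F) = algebraMap (ZMod p) F χ := mul_right_cancel₀ hw h1
  have hχ0 : χ ≠ 0 := by
    rintro rfl
    rw [map_zero] at h2
    exact u.ne_zero h2
  rw [← hu, orderOf_dvd_iff_pow_eq_one]
  ext
  rw [Units.val_pow_eq_pow_val, h2, ← map_pow, ZMod.pow_card_sub_one_eq_one hχ0, map_one,
    Units.val_one]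

end Irreducible

/-! ### Automorphism groups as matrix groups -/

section MulAut

/-- The automorphisms of a `ZMod n`-module are the automorphisms of its underlying group. -/
def LinearEquiv.equivMulAutMultiplicative (n : ℕ) (M : Type*) [AddCommGroup M] [Module (ZMod n) M] :
    (M ≃ₗ[ZMod n] M) ≃* MulAut (Multiplicative M) where
  toFun e := AddEquiv.toMultiplicative e.toAddEquiv
  invFun f := (AddEquiv.toMultiplicative.symm f).toLinearEquiv (ZMod.map_smul _)
  left_inv _ := rfl
  right_inv _ := rfl
  map_mul' _ _ := rfl

/-- `GL(2, p)` is the automorphism group of `Cyc p × Cyc p`. -/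
def Matrix.GeneralLinearGroup.equivMulAutCycProd (p : ℕ) :
    GL (Fin 2) (ZMod p) ≃* MulAut (Cyc p × Cyc p) :=
  ((Matrix.GeneralLinearGroup.toLin.trans
    (LinearMap.GeneralLinearGroup.generalLinearEquiv _ _)).trans
      (LinearEquiv.equivMulAutMultiplicative p (Fin 2 → ZMod p))).trans
        (MulAut.congr ((AddEquiv.toMultiplicative
          (LinearEquiv.finTwoArrow (ZMod p) (ZMod p)).toAddEquiv).trans
            (MulEquiv.prodMultiplicative _ _)))

end MulAut


/-! ### Counting classes of images in `GL(2, p)` -/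

theorem exists_range_eq_of_isCyclic {A Q : Type*} [Group A] [Group Q] {k : ℕ} {K : Subgroup A}
    (hK : IsCyclic K) (hn : Nat.card K ∣ k) : ∃ φ : Cyc k × Q →* A, φ.range = K := by
  obtain ⟨f, hf⟩ := exists_cyc_surjective hn
  refine ⟨((K.subtype.comp (zmodCyclicMulEquiv hK).toMonoidHom).comp f).comp
    (MonoidHom.fst _ _), ?_⟩
  rw [MonoidHom.range_comp_of_surjective _ _ Prod.fst_surjective,
    MonoidHom.range_comp_of_surjective _ _ hf,
    MonoidHom.range_comp_of_surjective _ _ (MulEquiv.surjective _), Subgroup.range_subtype]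

theorem card_dvd_of_isCyclic_of_range_eq {A : Type*} [Group A] {c d : ℕ} {K : Subgroup A}
    (hK : IsCyclic K) {φ : Cyc (c * d) × Cyc d →* A} (hφ : φ.range = K) : Nat.card K ∣ c * d := by
  subst hφ
  rw [← hK.exponent_eq_card]
  refine Monoid.exponent_dvd_of_forall_pow_eq_one ?_
  rintro ⟨_, z, rfl⟩
  have hz : z ^ (c * d) = 1 := Prod.ext (cyc_pow_eq_one _ _) (by

    exact orderOf_dvd_iff_pow_eq_one.1
      ((orderOf_dvd_of_pow_eq_one (cyc_pow_eq_one d z.2)).mul_left c))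
  exact Subtype.ext (by simp [← map_pow, hz])

theorem card_coprime_of_range_eq {A : Type*} [Group A] {c d p : ℕ} (hp : p.Prime)
    (hpcd : ¬ p ∣ c * d) {K : Subgroup A} {φ : Cyc (c * d) × Cyc d →* A} (hφ : φ.range = K) :
    (Nat.card K).Coprime p := by
  subst hφ
  have h1 : (c * d).Coprime p := ((Nat.Prime.coprime_iff_not_dvd hp).2 hpcd).symm
  have h2 : Nat.card φ.range ∣ c * d * d := by
    simpa only [Nat.card_prod, card_cyc] using Subgroup.card_range_dvd φ
  exact (h1.mul_left (Nat.Coprime.coprime_dvd_left (dvd_mul_left d c) h1)).coprime_dvd_left h2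

/-- The right-hand set is the set of orders of irreducible images; coprimality gives `τ(l) τ(s) -
τ(l)`, which also covers `s = 1`. -/
theorem Omega_eq_card {s l : ℕ} (hl : l ≠ 0) (hs : s ≠ 0) (hls : l.Coprime s) :
    Omega s l = ((l * s).divisors \ l.divisors).card := by
  rw [Finset.card_sdiff_of_subset (Nat.divisors_subset_of_dvd (mul_ne_zero hl hs) (dvd_mul_right l s)),
    hls.card_divisors_mul, Omega]
  split_ifs with h
  · simp [h]
  · rw [tau, tau, Nat.mul_sub, mul_one]

instance (p : ℕ) [Fact p.Prime] (H : Type) [Group H] : Finite (ReducibleCopies p H) :=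
  inferInstanceAs (Finite {K : Subgroup (GL (Fin 2) (ZMod p)) //
    IsReducibleSubgroup K ∧ Nonempty (K ≃* H)})

theorem card_imageConj_GL {p c d : ℕ} [hp : Fact p.Prime] (hc : Odd c) (hd : Odd d)
    (hpcd : ¬ p ∣ c * d) (hsq : Squarefree d) (hcop : c.Coprime d)
    (H : ℕ → Subgroup (Cyc (c * d) × Cyc d))
    (hH : ∀ t ∈ ((c * d).gcd (p - 1) * d.gcd (p - 1)).divisors, Nat.card (H t) = t) :
    Nat.card (Quotient (imageConjSetoid (Cyc (c * d) × Cyc d) (GL (Fin 2) (ZMod p)))) =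
      ∑ t ∈ ((c * d).gcd (p - 1) * d.gcd (p - 1)).divisors, Nred p (H t) +
        Omega ((c * d).gcd (p + 1)) ((c * d).gcd (p - 1)) := by
  set l := (c * d).gcd (p - 1) with hl
  set m := d.gcd (p - 1) with hm
  set s := (c * d).gcd (p + 1) with hs
  have hc0 : c ≠ 0 := hc.pos.ne'
  have hd0 : d ≠ 0 := hd.pos.ne'
  have hcd0 : c * d ≠ 0 := mul_ne_zero hc0 hd0
  have hl0 : l ≠ 0 := Nat.gcd_ne_zero_left hcd0
  have hm0 : m ≠ 0 := Nat.gcd_ne_zero_left hd0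
  have hs0 : s ≠ 0 := Nat.gcd_ne_zero_left hcd0
  have hp2 : p ^ 2 - 1 = (p - 1) * (p + 1) := by
    have := hp.out.one_le
    zify [this, Nat.one_le_pow 2 p hp.out.pos]
    ring
  -- A common divisor divides `(p + 1) - (p - 1) = 2`, and it is odd because `c * d` is.
  have hls : l.Coprime s := by
    have h1 : l.gcd s ∣ 2 := by
      have h := Nat.dvd_sub ((Nat.gcd_dvd_right l s).trans (Nat.gcd_dvd_right (c * d) (p + 1)))
        ((Nat.gcd_dvd_left l s).trans (Nat.gcd_dvd_right (c * d) (p - 1)))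
      have h2 : p + 1 - (p - 1) = 2 := by have := hp.out.one_le; lia
      rwa [h2] at h
    have h2 : Odd (l.gcd s) := Odd.of_dvd_nat (hc.mul hd)
      ((Nat.gcd_dvd_left l s).trans (Nat.gcd_dvd_left (c * d) (p - 1)))
    have h3 : (2 : ℕ).Coprime (l.gcd s) := Nat.coprime_two_left.2 h2
    exact Nat.eq_one_of_dvd_coprimes h3 h1 dvd_rfl
  have hirr (n : ℕ) : n ∈ (l * s).divisors \ l.divisors ↔
      n ∣ c * d ∧ n ∣ p ^ 2 - 1 ∧ ¬ n ∣ p - 1 := by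
    rw [Finset.mem_sdiff, Nat.mem_divisors, Nat.mem_divisors, hp2]
    constructor
    · rintro ⟨⟨h1, -⟩, h2⟩
      have h3 : n ∣ c * d := h1.trans (hls.mul_dvd_of_dvd_of_dvd (Nat.gcd_dvd_left _ _)
        (Nat.gcd_dvd_left _ _))
      exact ⟨h3, h1.trans (mul_dvd_mul (Nat.gcd_dvd_right _ _) (Nat.gcd_dvd_right _ _)),
        fun h => h2 ⟨Nat.dvd_gcd h3 h, hl0⟩⟩
    · rintro ⟨h1, h2, h3⟩
      exact ⟨⟨(Nat.dvd_gcd h1 h2).trans (Nat.gcd_mul_right_dvd_mul_gcd _ _ _),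
        mul_ne_zero hl0 hs0⟩, fun h => h3 (h.1.trans (Nat.gcd_dvd_right _ _))⟩
  have himg (K : Subgroup (GL (Fin 2) (ZMod p))) :=
    exists_range_eq_iff_hasCycDecomposition hc0 hcop hsq K
  have hHdec (t : ℕ) : HasCycDecomposition c d (H t) :=
    hasCycDecomposition_subgroup hc0 hcop hsq (H t)
  choose g hgord hgirr using fun n : {n // n ∈ (l * s).divisors \ l.divisors} =>
    exists_orderOf_eq_irreducible_charpoly (p := p) ((hirr n).1 n.2).2.1 ((hirr n).1 n.2).2.2
  -- Classes are parametrised by a reducible class of some order `t`, or by the order `n` of an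
  -- irreducible cyclic group with fixed generator `g n`. Conjugation preserves order and
  -- reducibility, which keeps the pieces disjoint.
  let F : ((t : (l * m).divisors) × Quotient (reducibleCopiesSetoid p (H t))) ⊕
      {n // n ∈ (l * s).divisors \ l.divisors} →
        Quotient (imageConjSetoid (Cyc (c * d) × Cyc d) (GL (Fin 2) (ZMod p))) :=
    Sum.elim
      (fun x => Quotient.lift (fun K : ReducibleCopies p (H x.1) =>
        (Quotient.mk (imageConjSetoid (Cyc (c * d) × Cyc d) (GL (Fin 2) (ZMod p)))
          ⟨K.1, (himg K.1).2 ((hHdec x.1).congr K.2.2.some.symm)⟩))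
        (fun K₁ K₂ h => Quotient.sound h) x.2)
      (fun n => Quotient.mk _ ⟨Subgroup.zpowers (g n), exists_range_eq_of_isCyclic inferInstance
        (by rw [Nat.card_zpowers, hgord]; exact ((hirr n).1 n.2).1)⟩)
  have hgred (n) : ¬ IsReducibleSubgroup (Subgroup.zpowers (g n)) := fun h => by
    obtain ⟨χ, hχ⟩ := h.exists_isRoot_charpoly (Subgroup.mem_zpowers (g n))
    exact Matrix.not_isRoot_of_irreducible_charpoly (hgirr n) χ hχ
  have hcard (K : Subgroup (GL (Fin 2) (ZMod p))) (x : GL (Fin 2) (ZMod p)) :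
      Nat.card (K.map (MulAut.conj x).toMonoidHom) = Nat.card K :=
    Nat.card_congr (K.equivMapOfInjective _ (MulAut.conj x).injective).symm.toEquiv
  have hF : Function.Bijective F := by
    constructor
    · rintro (⟨t₁, ⟨K₁⟩⟩ | n₁) (⟨t₂, ⟨K₂⟩⟩ | n₂) h
      · obtain ⟨x, hx⟩ := Quotient.exact h
        have ht : t₁ = t₂ := by
          obtain ⟨i₁⟩ := K₁.2.2
          obtain ⟨i₂⟩ := K₂.2.2
          apply Subtype.ext
          rw [← hH t₁ t₁.2, ← hH t₂ t₂.2, ← Nat.card_congr i₁.toEquiv, ← Nat.card_congr i₂.toEquiv]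
          change K₂.1 = K₁.1.map _ at hx
          rw [hx, hcard]
        subst ht
        exact congrArg (fun q => Sum.inl (Sigma.mk t₁ q)) (Quotient.sound ⟨x, hx⟩)
      · obtain ⟨x, hx⟩ := Quotient.exact h
        change Subgroup.zpowers (g n₂) = K₁.1.map _ at hx
        exact absurd (hx ▸ K₁.2.1.map_conj x) (hgred n₂)
      · obtain ⟨x, hx⟩ := Quotient.exact h.symm
        change Subgroup.zpowers (g n₁) = K₂.1.map _ at hx
        exact absurd (hx ▸ K₂.2.1.map_conj x) (hgred n₁)
      · obtain ⟨x, hx⟩ := Quotient.exact h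
        change Subgroup.zpowers (g n₂) = (Subgroup.zpowers (g n₁)).map _ at hx
        have := congrArg (fun K : Subgroup (GL (Fin 2) (ZMod p)) => Nat.card K) hx
        simp only [hcard, Nat.card_zpowers, hgord] at this
        exact congrArg Sum.inr (Subtype.ext this.symm)
    · rintro ⟨⟨K, φ, hφ⟩⟩
      have hK := (himg K).1 ⟨φ, hφ⟩
      by_cases hred : IsReducibleSubgroup K
      · have hmem : Nat.card K ∈ (l * m).divisors := Nat.mem_divisors.2
          ⟨hK.card_dvd hcop (hred.pow_eq_one (card_coprime_of_range_eq hp.out hpcd hφ)),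
            mul_ne_zero hl0 hm0⟩
        have hiso : Nonempty (K ≃* H (Nat.card K)) :=
          hK.nonempty_mulEquiv hc0 hcop hsq (hHdec _) (hH _ hmem).symm
        exact ⟨Sum.inl ⟨⟨Nat.card K, hmem⟩, Quotient.mk _ ⟨K, hred, hiso⟩⟩, rfl⟩
      · obtain ⟨h, rfl, hirrh⟩ := exists_generator_of_not_isReducibleSubgroup (by
          subst hφ
          rintro _ ⟨x, rfl⟩ _ ⟨y, rfl⟩
          rw [← map_mul, ← map_mul, mul_comm x y]) hred
        have hmem : orderOf h ∈ (l * s).divisors \ l.divisors := (hirr _).2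
          ⟨by simpa only [Nat.card_zpowers] using
              card_dvd_of_isCyclic_of_range_eq inferInstance hφ,
            orderOf_dvd_of_irreducible_charpoly hirrh,
            not_orderOf_dvd_of_irreducible_charpoly hirrh⟩
        obtain ⟨x, hx⟩ := exists_conj_zpowers_of_irreducible (hgirr ⟨_, hmem⟩) hirrh (hgord _)
        exact ⟨Sum.inr ⟨_, hmem⟩, Quotient.sound ⟨x, hx⟩⟩
  rw [← Nat.card_eq_of_bijective F hF, Nat.card_sum, Nat.card_sigma, Omega_eq_card hl0 hs0 hls,
    Nat.card_eq_fintype_card, Fintype.card_coe]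
  exact congrArg (· + _) (Finset.sum_coe_sort _ fun t => Nred p (H t))

/-! ### Counting images in the units of `ZMod (p ^ α)` -/

theorem IsCyclic.eq_of_card_eq {G : Type*} [Group G] [Finite G] [IsCyclic G] {K L : Subgroup G}
    (h : Nat.card K = Nat.card L) : K = L := by
  classical
  have := Fintype.ofFinite G
  -- In a cyclic group `x ^ k = 1` has at most `k` solutions, so a subgroup of order `k` is the full
  -- solution set.
  have key (K : Subgroup G) :
      (K : Set G).toFinset = Finset.univ.filter fun x : G => x ^ Nat.card K = 1 := by
    refine Finset.eq_of_subset_of_card_le (fun x hx => ?_) ?_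
    · rw [Set.mem_toFinset] at hx
      have := congrArg Subtype.val (pow_card_eq_one' (x := (⟨x, hx⟩ : K)))
      exact Finset.mem_filter.2 ⟨Finset.mem_univ x, this⟩
    · refine (IsCyclic.card_pow_eq_one_le Nat.card_pos).trans ?_
      rw [Set.toFinset_card, Nat.card_eq_fintype_card]
      rfl
  have h1 := key K
  rw [h, ← key L, Set.toFinset_inj] at h1
  exact SetLike.coe_injective h1

/-- The automorphisms of `Cyc n` are the multiplications by units of `ZMod n`. -/
def ZMod.mulAutCycEquivUnits (n : ℕ) : MulAut (Cyc n) ≃* (ZMod n)ˣ :=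
  (MulAutMultiplicative (ZMod n)).trans (ZMod.AddAutEquivUnits n).toMultiplicative

theorem card_imageConj_units {p c d α : ℕ} (hp : p.Prime) (hα : 1 ≤ α) (hc : c ≠ 0) (hd : d ≠ 0)
    (hpcd : ¬ p ∣ c * d) :
    Nat.card (Quotient (imageConjSetoid (Cyc (c * d) × Cyc d) (ZMod (p ^ α))ˣ)) =
      tau ((c * d).gcd (p - 1)) := by
  set l := (c * d).gcd (p - 1) with hl
  have hl0 : l ≠ 0 := Nat.gcd_ne_zero_left (mul_ne_zero hc hd)
  have hlp : l ∣ p - 1 := Nat.gcd_dvd_right _ _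
  have : NeZero (p ^ α) := ⟨pow_ne_zero _ hp.ne_zero⟩
  have hcard : Nat.card (ZMod (p ^ α))ˣ = p ^ (α - 1) * (p - 1) := by
    rw [Nat.card_eq_fintype_card, ZMod.card_units_eq_totient, Nat.totient_prime_pow hp hα]
  have hconj (K : Subgroup (ZMod (p ^ α))ˣ) (x : (ZMod (p ^ α))ˣ) :
      K.map (MulAut.conj x).toMonoidHom = K := by
    ext y
    simp
  -- For `p = 2` the unit group may fail to be cyclic, but then `p - 1 = 1` and only the trivial
  -- subgroup matters.
  have hA : IsCyclic (ZMod (p ^ α))ˣ ∨ p - 1 = 1 := by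
    by_cases h2 : p = 2
    · exact Or.inr (by rw [h2])
    · exact Or.inl (ZMod.isCyclic_units_of_prime_pow p hp h2 α)
  have hcyc : ∀ K : Subgroup (ZMod (p ^ α))ˣ, Nat.card K ∣ p - 1 → IsCyclic K := by
    intro K hK
    rcases hA with hA | hA
    · infer_instance
    · have := (Nat.card_eq_one_iff_unique.1 (Nat.dvd_one.1 (hA ▸ hK))).1
      infer_instance
  -- Images of `Q` have order prime to `p`, so the factor `p ^ (α - 1)` of the group order plays no
  -- role and the count does not depend on `α`.
  have hdvd (K : Subgroup (ZMod (p ^ α))ˣ) (hK : (Nat.card K).Coprime p) : Nat.card K ∣ p - 1 :=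
    (hK.pow_right (α - 1)).dvd_of_dvd_mul_left (hcard ▸ Subgroup.card_subgroup_dvd_card K)
  have huniq : ∀ K L : Subgroup (ZMod (p ^ α))ˣ, Nat.card K ∣ p - 1 → Nat.card K = Nat.card L →
      K = L := by
    intro K L hK hKL
    rcases hA with hA | hA
    · exact IsCyclic.eq_of_card_eq hKL
    · rw [hA, Nat.dvd_one] at hK
      exact (Subgroup.card_eq_one.1 hK).trans (Subgroup.card_eq_one.1 (hKL.symm.trans hK)).symm
  have hex : ∀ n : ℕ, n ∣ l → ∃ K : Subgroup (ZMod (p ^ α))ˣ, Nat.card K = n := by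
    intro n hn
    rcases hA with hA | hA
    · exact IsCyclic.exists_subgroup_card_eq (by
        rw [hcard]; exact (hn.trans hlp).mul_left _)
    · have hnp := hn.trans hlp
      rw [hA, Nat.dvd_one] at hnp
      exact ⟨⊥, by rw [Subgroup.card_bot, hnp]⟩
  let F : Quotient (imageConjSetoid (Cyc (c * d) × Cyc d) (ZMod (p ^ α))ˣ) → l.divisors :=
    Quotient.lift (fun K => ⟨Nat.card K.1, by
      obtain ⟨φ, hφ⟩ := K.2
      have h1 := hdvd _ (card_coprime_of_range_eq hp hpcd hφ)
      exact Nat.mem_divisors.2 ⟨Nat.dvd_gcd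
        (card_dvd_of_isCyclic_of_range_eq (hcyc _ h1) hφ) h1, hl0⟩⟩)
      fun K₁ K₂ ⟨x, hx⟩ => Subtype.ext (congrArg (fun K : Subgroup (ZMod (p ^ α))ˣ => Nat.card K)
        (hx.trans (hconj _ _)).symm)
  rw [tau, ← Fintype.card_coe, ← Nat.card_eq_fintype_card]
  refine Nat.card_eq_of_bijective F ⟨?_, ?_⟩
  · rintro ⟨K₁⟩ ⟨K₂⟩ h
    have h1 : Nat.card K₁.1 = Nat.card K₂.1 := congrArg Subtype.val h
    obtain ⟨φ, hφ⟩ := K₁.2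
    have h2 := huniq _ _ (hdvd _ (card_coprime_of_range_eq hp hpcd hφ)) h1
    exact congrArg _ (Subtype.ext h2)
  · rintro ⟨n, hn⟩
    obtain ⟨K, rfl⟩ := hex n (Nat.dvd_of_mem_divisors hn)
    have h1 := Nat.dvd_of_mem_divisors hn
    exact ⟨Quotient.mk _ ⟨K, exists_range_eq_of_isCyclic (hcyc _ (h1.trans hlp))
      (h1.trans (Nat.gcd_dvd_left _ _))⟩, rfl⟩

/-! ### The two counts of split extensions -/

theorem theorem1p3 (p c d l m s : ℕ) (hp : p.Prime) (hc : Odd c) (hd : Odd d)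
    (hpcd : ¬ p ∣ c * d) (hcube : ∀ r : ℕ, r.Prime → ¬ r ^ 3 ∣ c) (hsq : Squarefree d)
    (hcop : Nat.gcd c d = 1)
    (hl : l = Nat.gcd (c * d) (p - 1)) (hm : m = Nat.gcd d (p - 1))
    (hs : s = Nat.gcd (c * d) (p + 1)) :
    -- up to isomorphism there is exactly one subgroup of `Q` of each order `t ∣ l * m`
    ((∀ t ∈ (l * m).divisors, ∃ H : Subgroup (Cyc (c * d) × Cyc d), Nat.card H = t) ∧
      (∀ H₁ H₂ : Subgroup (Cyc (c * d) × Cyc d),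
        Nat.card H₁ = Nat.card H₂ → Nonempty (H₁ ≃* H₂)) ∧
      -- part (i), with `H t` any subgroup of `Q` of order `t`
      ∀ H : ℕ → Subgroup (Cyc (c * d) × Cyc d),
        (∀ t ∈ (l * m).divisors, Nat.card (H t) = t) →
        numSplitExtensions (Cyc p × Cyc p) (Cyc (c * d) × Cyc d)
          = ∑ t ∈ (l * m).divisors, Nred p (H t) + Omega s l) ∧
    -- part (ii)
    (∀ α : ℕ, 1 ≤ α →
      numSplitExtensions (Cyc (p ^ α)) (Cyc (c * d) × Cyc d) = tau l) := by
  subst hl hm hs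
  have := Fact.mk hp
  have hc0 : c ≠ 0 := hc.pos.ne'
  have hd0 : d ≠ 0 := hd.pos.ne'
  have hcopQ : p.Coprime (Nat.card (Cyc (c * d) × Cyc d)) := by
    have h1 : p.Coprime (c * d) := (Nat.Prime.coprime_iff_not_dvd hp).2 hpcd
    rw [Nat.card_prod, card_cyc, card_cyc]
    exact h1.mul_right (Nat.Coprime.coprime_dvd_right (dvd_mul_left d c) h1)
  refine ⟨⟨fun t ht => ?_, fun H₁ H₂ h => ?_, fun H hH => ?_⟩, fun α hα => ?_⟩
  · exact exists_subgroup_cyc_prod_card_eq (mul_ne_zero hc0 hd0) hd0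
      ((Nat.dvd_of_mem_divisors ht).trans
        (mul_dvd_mul (Nat.gcd_dvd_left _ _) (Nat.gcd_dvd_left _ _)))
  · exact (hasCycDecomposition_subgroup hc0 hcop hsq H₁).nonempty_mulEquiv hc0 hcop hsq
      (hasCycDecomposition_subgroup hc0 hcop hsq H₂) h
  · rw [← card_imageConj_GL hc hd hpcd hsq hcop H hH]
    refine numSplitExtensions_eq_card_imageConj ?_
      (Matrix.GeneralLinearGroup.equivMulAutCycProd p) (exists_mulAut_of_range_eq hc0 hcop hsq)
    rw [Nat.card_prod, card_cyc]
    exact hcopQ.mul_left hcopQ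
  · rw [← card_imageConj_units hp hα hc0 hd0 hpcd]
    refine numSplitExtensions_eq_card_imageConj ?_ (ZMod.mulAutCycEquivUnits _).symm
      (exists_mulAut_of_range_eq hc0 hcop hsq)
    rw [card_cyc]
    exact hcopQ.pow_left α
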